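/- Write points of the upper half-space $\mathbb R^{n+1}_+$ as $(t,y)$ with $t>0$, $y\in\mathbb R^n$. For a locally square integrable complex-valued function $g$ on $\mathbb R^{n+1}_+$ and $\alpha>0$, let $$A^{(\alpha)}g(x)=\Big(\int_{\mathbb R^{n+1}_+}\frac{1_{B(x,\alpha t)}(y)}{t^n}\,|g(t,y)|^2\,\frac{dy\,dt}{t}\Big)^{1/2},\qquad x\in\mathbb R^n.$$ For $0<p<\infty$ put $\|g\|_{T^{p,2}_\alpha}=\|A^{(\alpha)}g\|_{L^p(\mathbb R^n)}$. For $p=\infty$ let $\|g\|_{T^{\infty,2}_\alpha}$ be the infimum of the $C\ge 0$ such that $\int_{T_\alpha B}|g(t,y)|^2\,\frac{dy\,dt}{t}\le C^2\,\frac{|B|}{\alpha^n}$ for every open ball $B=B(x,r)$, where $T_\alpha B=\{(t,y): 0<t<r/\alpha,\ y\in B(x,r-\alpha t)\}$. These quantities take values in $[0,\infty]$. For $\rho>0$ set $\underline h(p,\rho)=\min(\rho^{-n/2},\rho^{-n/p})$ and $\overline h(p,\rho)=\max(\rho^{-n/2},\rho^{-n/p})$, with $n/\infty=0$. **Theorem.**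 Let $0<p\le\infty$. (i) There are constants $C,C'>0$, depending only on $n$ and $p$, such that for all $\alpha,\beta>0$ and all locally square integrable $g$, $$C\,\underline h(p,\alpha/\beta)\,\|g\|_{T^{p,2}_\alpha}\le\|g\|_{T^{p,2}_\beta}\le C'\,\overline h(p,\alpha/\beta)\,\|g\|_{T^{p,2}_\alpha}.$$ (ii) The dependence on $\alpha/\beta$ is best possible: there are constants $c,c'>0$, depending only on $n$ and $p$, such that for all $\alpha,\beta>0$ there are locally square integrable $g_1,g_2$ with $0<\|g_i\|_{T^{p,2}_\alpha}<\infty$ ($i=1,2$) and $$\|g_1\|_{T^{p,2}_\beta}\le c\,\underline h(p,\alpha/\beta)\,\|g_1\|_{T^{p,2}_\alpha},\qquad \|g_2\|_{T^{p,2}_\beta}\ge c'\,\overline h(p,\alpha/\beta)\,\|g_2\|_{T^{p,2}_\alpha}.$$ (iii) In particular, there is a constant $C>0$, depending only on $n$ and $p$, such that for all $\alpha>1$ and all locally square integrable $g$, $$\|g\|_{T^{p,2}_\alpha}\le C\,\alpha^{n/\min(2,p)}\,\|g\|_{T^{p,2}_1},\qquad \|g\|_{T^{p,2}_1}\le C\,\alpha^{-n/\max(2,p)}\,\|g\|_{T^{p,2}_\alpha}.$$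 -/

import Mathlib

open MeasureTheory Set
open scoped ENNReal

namespace TentSpace

/-- The upper half-space `ℝ^{n+1}_+`, with points written `z = (t, y)`, `t > 0`, `y ∈ ℝⁿ`. -/
def upperHalfSpace (n : ℕ) : Set (ℝ × EuclideanSpace ℝ (Fin n)) :=
  {z | 0 < z.1}

/-- `g` is locally square integrable on the (open) upper half-space: it is (measurable and) square
integrable on each compact subset. -/
def LocallySquareIntegrable {n : ℕ} (g : ℝ × EuclideanSpace ℝ (Fin n) → ℂ) : Prop :=
  ∀ K : Set (ℝ × EuclideanSpace ℝ (Fin n)), IsCompact K → K ⊆ upperHalfSpace n →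
    MemLp g 2 (volume.restrict K)

/-- The area functional
`A^{(α)} g (x) = (∫_{ℝ^{n+1}_+} 1_{B(x, α t)}(y) t⁻ⁿ |g(t,y)|² dy dt / t)^{1/2}`,
with values in `[0, ∞]`. -/
noncomputable def areaFunctional {n : ℕ} (α : ℝ) (g : ℝ × EuclideanSpace ℝ (Fin n) → ℂ)
    (x : EuclideanSpace ℝ (Fin n)) : ℝ≥0∞ :=
  (∫⁻ z in upperHalfSpace n,
    (Metric.ball x (α * z.1)).indicator (fun _ => (1 : ℝ≥0∞)) z.2 / ENNReal.ofReal z.1 ^ n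
      * ‖g z‖ₑ ^ 2 / ENNReal.ofReal z.1) ^ (1 / 2 : ℝ)

/-- The tent with aperture `α` above the ball `B(x, r)`. -/
def tent {n : ℕ} (α : ℝ) (x : EuclideanSpace ℝ (Fin n)) (r : ℝ) :
    Set (ℝ × EuclideanSpace ℝ (Fin n)) :=
  {z | 0 < z.1 ∧ z.1 < r / α ∧ z.2 ∈ Metric.ball x (r - α * z.1)}

/-- The Carleson norm with aperture `α`: the infimum of the `C` such that
`∫_{T_α B} |g(t,y)|² dy dt / t ≤ C² |B| / αⁿ` for all balls `B` (it is `∞` if there is no finite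
such `C`). -/
noncomputable def carlesonNorm {n : ℕ} (α : ℝ) (g : ℝ × EuclideanSpace ℝ (Fin n) → ℂ) : ℝ≥0∞ :=
  sInf {C : ℝ≥0∞ | ∀ (x : EuclideanSpace ℝ (Fin n)) (r : ℝ), 0 < r →
    ∫⁻ z in tent α x r, ‖g z‖ₑ ^ 2 / ENNReal.ofReal z.1
      ≤ C ^ 2 * (volume (Metric.ball x r) / ENNReal.ofReal α ^ n)}

open Classical in
/-- The tent space (quasi-)norm `‖g‖_{T^{p,2}_α}`, with values in `[0, ∞]`: the `L^p` (quasi-)norm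
of `A^{(α)} g` if `p < ∞`, the Carleson norm if `p = ∞`. -/
noncomputable def tentNorm {n : ℕ} (p : ℝ≥0∞) (α : ℝ)
    (g : ℝ × EuclideanSpace ℝ (Fin n) → ℂ) : ℝ≥0∞ :=
  if p = ∞ then carlesonNorm α g else eLpNorm (areaFunctional α g) p volume

/-- The exponent `n / p`, which is `0` for `p = ∞`. -/
noncomputable def expo (n : ℕ) (p : ℝ≥0∞) : ℝ := n * (p⁻¹).toReal

/-- `min (α^{-n/2}, α^{-n/p})`. -/
noncomputable def hLower (n : ℕ) (p : ℝ≥0∞) (α : ℝ) : ℝ :=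
  min (α ^ (-expo n 2)) (α ^ (-expo n p))

/-- `max (α^{-n/2}, α^{-n/p})`. -/
noncomputable def hUpper (n : ℕ) (p : ℝ≥0∞) (α : ℝ) : ℝ :=
  max (α ^ (-expo n 2)) (α ^ (-expo n p))

end TentSpace

/-! For finite `p` the norm depends only on F_α(x), the mass that t⁻ⁿ|g|² dy dt/t gives to the cone
of aperture α with vertex x: it is the L^p norm of F_α^{1/2}. With q = p/2 and κ = (β/α)ⁿ, the upper
estimate reads ∫ F_β^q ≤ C max(κ^q, κ) ∫ F_α^q, which is `exists_lintegral_coneMeasure_rpow_le`. The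
tool is a maximal function with two apertures, `ntMax`, whose weak type (1,1) constant is followed
explicitly.

For q = 1 the estimate is Tonelli's theorem. For q > 1 it is dual: replacing h on each ball B(y, βt)
by its mean gives ∫ F_β h ≤ κ ∫ F_α Mh, and M is bounded on L^r with the r-th power of its norm at
most a multiple of max(1, 1/κ) (`lintegral_ntMax_rpow_le`). For q < 1 level sets are compared: with
O = {cF_α > l} and O* = {M1_O > 1/2}, one has |O*| ≤ C max(1, κ)|O|, while off O* the integral of
F_β is at most 2κ times that of F_α off O (`mul_volume_lt_coneMeasure_le`). Integrating against
l^{q-2} dl and taking c = min(1, κ) balances both terms.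

For `p = ∞` a β-tent lies in the α-tent over a dilated ball (`carlesonNorm_le`). The lower estimate
is the upper one with the apertures interchanged.

Sharpness comes from indicators of (1,2) × B(0,R). There F_α is comparable to min(α,R)ⁿ on a ball of
radius comparable to max(α,R), so the norm is comparable to min(α,R)^{n/2} max(α,R)^{n/p}. Taking R
= max(α,β) or R = min(α,β) realizes the two powers of α/β. -/

namespace TentSpace

/-! ### The two-aperture maximal function and its weak type (1,1) bound. -/

section Maximal

section

variable {E : Type*} [NormedAddCommGroup E] [MeasureSpace E]

/-- The maximal function `x ↦ sup ⨍_{B(y, b t)} f`, the supremum being over all `(t, y)` such that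
`x ∈ B(y, a t)`. -/
noncomputable def ntMax (a b : ℝ) (f : E → ℝ≥0∞) (x : E) : ℝ≥0∞ :=
  ⨆ (z : ℝ × E) (_ : x ∈ Metric.ball z.2 (a * z.1)),
    (∫⁻ y in Metric.ball z.2 (b * z.1), f y) / volume (Metric.ball z.2 (b * z.1))

theorem lt_ntMax_iff {a b : ℝ} {f : E → ℝ≥0∞} {x : E} {l : ℝ≥0∞} :
    l < ntMax a b f x ↔ ∃ z : ℝ × E, x ∈ Metric.ball z.2 (a * z.1) ∧
      l < (∫⁻ y in Metric.ball z.2 (b * z.1), f y) / volume (Metric.ball z.2 (b * z.1)) := by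
  simp only [ntMax, lt_iSup_iff, exists_prop]

theorem setOf_lt_ntMax (a b : ℝ) (f : E → ℝ≥0∞) (l : ℝ≥0∞) :
    {x | l < ntMax a b f x} = ⋃ z ∈ {z : ℝ × E | l <
      (∫⁻ y in Metric.ball z.2 (b * z.1), f y) / volume (Metric.ball z.2 (b * z.1))},
      Metric.ball z.2 (a * z.1) := by
  ext x
  simp only [mem_ofPred_eq, lt_ntMax_iff, mem_iUnion, exists_prop, and_comm]

theorem isOpen_lt_ntMax (a b : ℝ) (f : E → ℝ≥0∞) (l : ℝ≥0∞) :
    IsOpen {x | l < ntMax a b f x} := by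
  rw [setOf_lt_ntMax]
  exact isOpen_biUnion fun _ _ => Metric.isOpen_ball

theorem measurable_ntMax [BorelSpace E] (a b : ℝ) (f : E → ℝ≥0∞) : Measurable (ntMax a b f) :=
  measurable_of_Ioi fun l => (isOpen_lt_ntMax a b f l).measurableSet

end

variable {E : Type*} [NormedAddCommGroup E] [NormedSpace ℝ E] [FiniteDimensional ℝ E]
  [MeasureSpace E] [BorelSpace E] [(volume : Measure E).IsAddHaarMeasure]

theorem volume_ball_mul {a b : ℝ} (ha : 0 < a) (hb : 0 < b) (x y : E) (t : ℝ) :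
    volume (Metric.ball x (b * t))
      = ENNReal.ofReal ((b / a) ^ Module.finrank ℝ E) * volume (Metric.ball y (a * t)) := by
  have h : b * t = b / a * (a * t) := by field_simp
  rw [h, Measure.addHaar_ball_mul_of_pos _ _ (div_pos hb ha),
    Measure.addHaar_ball_center volume y]

/-- Vitali's covering lemma is applied to the balls B(y, (a+b)t). This radius does two jobs:
disjointness passes to the averaging balls B(y, bt), and the fivefold enlargements cover the balls
B(y, at) that make up the level set. The constant is the volume ratio of radii 5(a+b)t and bt. -/
theorem mul_volume_lt_ntMax_le {a b : ℝ} (ha : 0 < a) (hb : 0 < b) (f : E → ℝ≥0∞) (l : ℝ≥0∞) :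
    l * volume {x | l < ntMax a b f x}
      ≤ ENNReal.ofReal ((5 * (a + b) / b) ^ Module.finrank ℝ E) * ∫⁻ x, f x := by
  -- Inner regularity leaves finitely many balls, so the radii are bounded as Vitali's lemma
  -- requires.
  rw [(isOpen_lt_ntMax a b f l).measure_eq_iSup_isCompact]
  simp only [ENNReal.mul_iSup]
  refine iSup₂_le fun K hK => iSup_le fun hKc => ?_
  rw [setOf_lt_ntMax] at hK
  obtain ⟨s, hs, hsf, hKs⟩ := hKc.elim_finite_subcover_image
    (fun _ _ => Metric.isOpen_ball) hK
  obtain ⟨R, hR⟩ := (hsf.image fun z : ℝ × E => (a + b) * z.1).bddAbove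
  obtain ⟨u, hus, hdisj, hcov⟩ := Vitali.exists_disjoint_subfamily_covering_enlargement_closedBall
    s (fun z : ℝ × E => z.2) (fun z => (a + b) * z.1) R
    (fun z hz => hR (mem_image_of_mem _ hz)) 5 (by norm_num)
  have huf : u.Finite := hsf.subset hus
  have hab : 0 < 5 * (a + b) := by positivity
  -- For nonpositive `z.1` the averaging ball is empty and its mean is 0/0 = 0, which cannot exceed
  -- `l`.
  have hpos : ∀ z : ℝ × E, z ∈ s → 0 < z.1 := by
    intro z hz
    by_contra hneg
    have h0 : b * z.1 ≤ 0 := mul_nonpos_of_nonneg_of_nonpos hb.le (not_lt.1 hneg)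
    have := hs hz
    simp [Metric.ball_eq_empty.2 h0] at this
  calc l * volume K
      ≤ l * volume (⋃ z ∈ u, Metric.closedBall z.2 (5 * (a + b) * z.1)) := by
        gcongr
        refine hKs.trans (iUnion₂_subset fun z hz => ?_)
        obtain ⟨w, hw, hzw⟩ := hcov z hz
        refine subset_trans ?_ (subset_biUnion_of_mem hw)
        refine subset_trans ?_ (hzw.trans (by rw [mul_assoc]))
        refine Metric.ball_subset_closedBall.trans (Metric.closedBall_subset_closedBall ?_)
        nlinarith [hpos z hz]
    _ ≤ l * ∑ z ∈ huf.toFinset, volume (Metric.closedBall z.2 (5 * (a + b) * z.1)) := by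
        gcongr
        have := measure_biUnion_finset_le (μ := (volume : Measure E)) huf.toFinset
          (fun z => Metric.closedBall z.2 (5 * (a + b) * z.1))
        simpa using this
    _ = ENNReal.ofReal ((5 * (a + b) / b) ^ Module.finrank ℝ E) *
          ∑ z ∈ huf.toFinset, l * volume (Metric.ball z.2 (b * z.1)) := by
        simp only [Finset.mul_sum]
        refine Finset.sum_congr rfl fun z hz => ?_
        have hz' : 0 < z.1 := hpos z (hus (by simpa using hz))
        rw [Measure.addHaar_closedBall _ _ (by positivity),
          ← Measure.addHaar_ball_of_pos _ z.2 (by positivity), volume_ball_mul hb hab z.2 z.2]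
        ring
    _ ≤ ENNReal.ofReal ((5 * (a + b) / b) ^ Module.finrank ℝ E) *
          ∑ z ∈ huf.toFinset, ∫⁻ y in Metric.ball z.2 (b * z.1), f y := by
        gcongr with z hz
        exact ENNReal.mul_le_of_le_div (hs (hus (by simpa using hz))).le
    _ = ENNReal.ofReal ((5 * (a + b) / b) ^ Module.finrank ℝ E) *
          ∫⁻ y in ⋃ z ∈ huf.toFinset, Metric.ball z.2 (b * z.1), f y := by
        rw [lintegral_biUnion_finset]
        · intro z hz w hw hzw
          have hz' : z ∈ u := by simpa using hz
          have hw' : w ∈ u := by simpa using hw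
          refine (hdisj hz' hw' hzw).mono ?_ ?_ <;>
          refine Metric.ball_subset_closedBall.trans (Metric.closedBall_subset_closedBall ?_)
          · nlinarith [hpos z (hus hz')]
          · nlinarith [hpos w (hus hw')]
        · exact fun _ _ => measurableSet_ball
    _ ≤ _ := by
        gcongr
        exact Measure.restrict_le_self

end Maximal

/-! ### Layer-cake formulas for super- and sublevel sets. -/

section LayerCake

theorem ofReal_mul_lintegral_rpow_lt {q : ℝ} (hq : 0 < q) (f : ℝ≥0∞) :
    ENNReal.ofReal q * ∫⁻ l in Ioi (0 : ℝ),
      {l : ℝ | ENNReal.ofReal l < f}.indicator (fun l => ENNReal.ofReal l ^ (q - 1)) l = f ^ q := by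
  have hms : ∀ f : ℝ≥0∞, MeasurableSet {l : ℝ | ENNReal.ofReal l < f} := fun f =>
    measurableSet_lt (by fun_prop) (by fun_prop)
  have key : ∀ y : ℝ, 0 ≤ y → ENNReal.ofReal q * ∫⁻ l in Ioi (0 : ℝ),
      {l : ℝ | ENNReal.ofReal l < ENNReal.ofReal y}.indicator
        (fun l => ENNReal.ofReal l ^ (q - 1)) l = ENNReal.ofReal y ^ q := by
    intro y hy
    rw [setLIntegral_indicator (hms _)]
    have hset : {l : ℝ | ENNReal.ofReal l < ENNReal.ofReal y} ∩ Ioi 0 = Ioo 0 y := by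
      ext l
      simp only [mem_inter_iff, mem_ofPred_eq, mem_Ioi, mem_Ioo]
      constructor
      · rintro ⟨h, h0⟩
        exact ⟨h0, (ENNReal.ofReal_lt_ofReal_iff_of_nonneg h0.le).1 h⟩
      · rintro ⟨h0, h⟩
        exact ⟨(ENNReal.ofReal_lt_ofReal_iff_of_nonneg h0.le).2 h, h0⟩
    rw [hset]
    have hint : IntegrableOn (fun l : ℝ => l ^ (q - 1)) (Ioc 0 y) :=
      (intervalIntegrable_iff_integrableOn_Ioc_of_le hy).1
        (intervalIntegral.intervalIntegrable_rpow' (by linarith))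
    have hval : ∫ l in Ioc 0 y, l ^ (q - 1) = y ^ q / q := by
      rw [← intervalIntegral.integral_of_le hy, integral_rpow (Or.inl (by linarith))]
      simp [Real.zero_rpow hq.ne']
    rw [setLIntegral_congr (Ioo_ae_eq_Ioc (a := (0 : ℝ)) (b := y)),
      setLIntegral_congr_fun (g := fun l => ENNReal.ofReal (l ^ (q - 1))) measurableSet_Ioc
        (fun l hl => ENNReal.ofReal_rpow_of_pos hl.1),
      ← ofReal_integral_eq_lintegral_ofReal hint
        ((ae_restrict_iff' measurableSet_Ioc).2 (Filter.Eventually.of_forall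
          fun l hl => Real.rpow_nonneg hl.1.le _)), hval, ← ENNReal.ofReal_mul hq.le,
      ENNReal.ofReal_rpow_of_nonneg hy hq.le]
    congr 1
    field_simp
  by_cases hf : f = ∞
  · subst hf
    rw [ENNReal.top_rpow_of_pos hq, eq_top_iff]
    refine ENNReal.le_of_forall_nnreal_lt fun c _ => ?_
    -- An infinite `f` dominates every finite level; the level c^{1/q} bounds the integral below by
    -- an arbitrary `c`.
    have h1 := key ((c : ℝ) ^ q⁻¹) (by positivity)
    rw [ENNReal.ofReal_rpow_of_nonneg (by positivity) hq.le, ← Real.rpow_mul c.coe_nonneg,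
      inv_mul_cancel₀ hq.ne', Real.rpow_one, ENNReal.ofReal_coe_nnreal] at h1
    rw [← h1]
    gcongr ENNReal.ofReal q * ?_
    refine lintegral_mono fun l =>
      indicator_le_indicator_of_subset (fun l _ => ?_) (fun _ => zero_le) _
    simp
  · have := key f.toReal ENNReal.toReal_nonneg
    rwa [ENNReal.ofReal_toReal hf] at this

/-- Since q - 2 < -1, the power is integrable at infinity, and the integral runs over l ≥ f. At f =
0 the right side is infinite. -/
theorem lintegral_rpow_le_of_le {q : ℝ} (hq : q < 1) (f : ℝ≥0∞) :
    ∫⁻ l in Ioi (0 : ℝ),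
      {l : ℝ | f ≤ ENNReal.ofReal l}.indicator (fun l => ENNReal.ofReal l ^ (q - 2)) l
      ≤ ENNReal.ofReal (1 - q)⁻¹ * f ^ (q - 1) := by
  have hq' : 0 < (1 - q)⁻¹ := inv_pos.2 (by linarith)
  rcases eq_or_ne f 0 with rfl | h0
  · rw [ENNReal.zero_rpow_of_neg (by linarith), ENNReal.mul_top (by simpa using hq)]
    exact le_top
  rcases eq_or_ne f ∞ with rfl | hf
  · simp
  lift f to NNReal using hf
  have hf0 : 0 < (f : ℝ) := by
    have : f ≠ 0 := by simpa using h0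
    positivity
  have hms : MeasurableSet {l : ℝ | (f : ℝ≥0∞) ≤ ENNReal.ofReal l} :=
    measurableSet_le (by fun_prop) (by fun_prop)
  rw [setLIntegral_indicator hms]
  have hset : {l : ℝ | (f : ℝ≥0∞) ≤ ENNReal.ofReal l} ∩ Ioi 0 ⊆ Ici (f : ℝ) := by
    rintro l ⟨h, h0⟩
    rw [mem_ofPred_eq, ← ENNReal.ofReal_coe_nnreal, ENNReal.ofReal_le_ofReal_iff (le_of_lt h0)] at h
    exact h
  refine (lintegral_mono_set hset).trans ?_
  have hint : IntegrableOn (fun l : ℝ => l ^ (q - 2)) (Ioi (f : ℝ)) :=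
    integrableOn_Ioi_rpow_of_lt (by linarith) hf0
  rw [setLIntegral_congr Ioi_ae_eq_Ici.symm,
    setLIntegral_congr_fun (g := fun l => ENNReal.ofReal (l ^ (q - 2))) measurableSet_Ioi
        (fun l hl => ENNReal.ofReal_rpow_of_pos (hf0.trans hl)),
    ← ofReal_integral_eq_lintegral_ofReal hint
        ((ae_restrict_iff' measurableSet_Ioi).2 (Filter.Eventually.of_forall
          fun l hl => Real.rpow_nonneg (hf0.trans hl).le _)),
    integral_Ioi_rpow_of_lt (by linarith) hf0, ← ENNReal.ofReal_coe_nnreal,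
    ENNReal.ofReal_rpow_of_pos hf0, ← ENNReal.ofReal_mul hq'.le]
  refine ENNReal.ofReal_le_ofReal (le_of_eq ?_)
  rw [show q - 2 + 1 = q - 1 by ring, show (1 - q)⁻¹ = -(q - 1)⁻¹ by rw [← inv_neg]; congr 1; ring]
  rw [div_eq_mul_inv]
  ring

variable {X : Type*} [MeasurableSpace X]

theorem lintegral_rpow_eq_lintegral_measure_lt (μ : Measure X) [SFinite μ] {f : X → ℝ≥0∞}
    (hf : Measurable f) {q : ℝ} (hq : 0 < q) :
    ∫⁻ x, f x ^ q ∂μ = ENNReal.ofReal q *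
      ∫⁻ l in Ioi (0 : ℝ), ENNReal.ofReal l ^ (q - 1) * μ {x | ENNReal.ofReal l < f x} := by
  have hms : MeasurableSet {w : X × ℝ | ENNReal.ofReal w.2 < f w.1} :=
    measurableSet_lt (by fun_prop) (by fun_prop)
  have hm : Measurable fun w : X × ℝ => {w : X × ℝ | ENNReal.ofReal w.2 < f w.1}.indicator
      (fun w => ENNReal.ofReal w.2 ^ (q - 1)) w :=
    Measurable.indicator (by fun_prop) hms
  calc ∫⁻ x, f x ^ q ∂μ
      = ∫⁻ x, (ENNReal.ofReal q * ∫⁻ l in Ioi (0 : ℝ),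
          {w : X × ℝ | ENNReal.ofReal w.2 < f w.1}.indicator (fun w => ENNReal.ofReal w.2 ^ (q - 1)) (x, l)) ∂μ := by
        refine lintegral_congr fun x => ?_
        rw [← ofReal_mul_lintegral_rpow_lt hq]
        rfl
    _ = _ := by
        rw [lintegral_const_mul' _ _ ENNReal.ofReal_ne_top, lintegral_lintegral_swap hm.aemeasurable]
        congr 1
        refine lintegral_congr fun l => ?_
        rw [← lintegral_indicator_const (measurableSet_lt (by fun_prop) hf)]
        rfl

theorem lintegral_rpow_mul_measure_le (μ : Measure X) [SFinite μ] {f : X → ℝ≥0∞}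
    (hf : Measurable f) {q : ℝ} (hq : q < 1) :
    ∫⁻ l in Ioi (0 : ℝ), ENNReal.ofReal l ^ (q - 2) * μ {x | f x ≤ ENNReal.ofReal l}
      ≤ ENNReal.ofReal (1 - q)⁻¹ * ∫⁻ x, f x ^ (q - 1) ∂μ := by
  have hms : MeasurableSet {w : X × ℝ | f w.1 ≤ ENNReal.ofReal w.2} :=
    measurableSet_le (by fun_prop) (by fun_prop)
  have hm : Measurable fun w : X × ℝ => {w : X × ℝ | f w.1 ≤ ENNReal.ofReal w.2}.indicator
      (fun w => ENNReal.ofReal w.2 ^ (q - 2)) w :=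
    Measurable.indicator (by fun_prop) hms
  calc ∫⁻ l in Ioi (0 : ℝ), ENNReal.ofReal l ^ (q - 2) * μ {x | f x ≤ ENNReal.ofReal l}
      = ∫⁻ x, (∫⁻ l in Ioi (0 : ℝ), {w : X × ℝ | f w.1 ≤ ENNReal.ofReal w.2}.indicator
          (fun w => ENNReal.ofReal w.2 ^ (q - 2)) (x, l)) ∂μ := by
        rw [lintegral_lintegral_swap hm.aemeasurable]
        refine lintegral_congr fun l => ?_
        rw [← lintegral_indicator_const (measurableSet_le hf (by fun_prop))]
        rfl
    _ ≤ ∫⁻ x, ENNReal.ofReal (1 - q)⁻¹ * f x ^ (q - 1) ∂μ :=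
        lintegral_mono fun x => lintegral_rpow_le_of_le hq (f x)
    _ = _ := lintegral_const_mul' _ _ ENNReal.ofReal_ne_top

end LayerCake

/-! ### The L^r bound for the maximal function, r > 1. -/

section StrongType

variable {E : Type*} [NormedAddCommGroup E] [NormedSpace ℝ E] [FiniteDimensional ℝ E]
  [MeasureSpace E] [BorelSpace E] [(volume : Measure E).IsAddHaarMeasure]

/-- Marcinkiewicz truncation: the part of `h` that is at most l/2 contributes at most l/2 to every
mean, so the part where 2h > l must have a mean above l/2, and the weak type bound applies to it. -/
theorem ofReal_mul_volume_lt_ntMax_le {a b : ℝ} (ha : 0 < a) (hb : 0 < b) {h : E → ℝ≥0∞}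
    (hh : Measurable h) (l : ℝ) :
    ENNReal.ofReal l * volume {x | ENNReal.ofReal l < ntMax a b h x}
      ≤ 2 * ENNReal.ofReal ((5 * (a + b) / b) ^ Module.finrank ℝ E) *
        volume.withDensity h {x | ENNReal.ofReal l < 2 * h x} := by
  set L := ENNReal.ofReal l with hL
  have hms : MeasurableSet {x | L < 2 * h x} := measurableSet_lt (by fun_prop) (by fun_prop)
  have hle : ∀ y, h y ≤ {x | L < 2 * h x}.indicator h y + L / 2 := by
    intro y
    by_cases hy : L < 2 * h y
    · rw [indicator_of_mem (by exact hy)]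
      exact le_self_add
    · rw [indicator_of_notMem (by exact hy), zero_add]
      rw [ENNReal.le_div_iff_mul_le (by simp) (by simp), mul_comm]
      exact not_lt.1 hy
  have hsub : {x | L < ntMax a b h x} ⊆
      {x | L / 2 < ntMax a b ({x | L < 2 * h x}.indicator h) x} := by
    intro x hx
    obtain ⟨z, hxz, hz⟩ := lt_ntMax_iff.1 hx
    refine lt_ntMax_iff.2 ⟨z, hxz, ?_⟩
    have h1 : (∫⁻ y in Metric.ball z.2 (b * z.1), h y) / volume (Metric.ball z.2 (b * z.1)) ≤
        (∫⁻ y in Metric.ball z.2 (b * z.1), {x | L < 2 * h x}.indicator h y) /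
          volume (Metric.ball z.2 (b * z.1)) + L / 2 := by
      calc _ ≤ (∫⁻ y in Metric.ball z.2 (b * z.1), ({x | L < 2 * h x}.indicator h y + L / 2)) /
            volume (Metric.ball z.2 (b * z.1)) := by
            gcongr with y
            exact hle y
        _ ≤ _ := by
            rw [lintegral_add_right _ measurable_const, setLIntegral_const, ENNReal.add_div]
            refine add_le_add_right ?_ _
            rw [mul_div_assoc]
            exact mul_le_of_le_one_right' ENNReal.div_self_le_one
    have h2 := hz.trans_le h1
    exact lt_of_add_lt_add_right ((ENNReal.add_halves L).trans_lt h2)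
  calc L * volume {x | L < ntMax a b h x}
      ≤ L * volume {x | L / 2 < ntMax a b ({x | L < 2 * h x}.indicator h) x} := by gcongr
    _ = 2 * (L / 2 * volume {x | L / 2 < ntMax a b ({x | L < 2 * h x}.indicator h) x}) := by
        rw [← mul_assoc, ENNReal.mul_div_cancel (by simp) (by simp)]
    _ ≤ 2 * (ENNReal.ofReal ((5 * (a + b) / b) ^ Module.finrank ℝ E) *
          ∫⁻ x, {x | L < 2 * h x}.indicator h x) := by
        gcongr 2 * ?_
        exact mul_volume_lt_ntMax_le ha hb _ _
    _ = _ := by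
        rw [lintegral_indicator hms, withDensity_apply _ hms, mul_assoc]

theorem lintegral_ntMax_rpow_le {a b : ℝ} (ha : 0 < a) (hb : 0 < b) {h : E → ℝ≥0∞}
    (hh : Measurable h) {r : ℝ} (hr : 1 < r) :
    ∫⁻ x, ntMax a b h x ^ r ≤ ENNReal.ofReal (2 ^ r * r / (r - 1)) *
      ENNReal.ofReal ((5 * (a + b) / b) ^ Module.finrank ℝ E) * ∫⁻ x, h x ^ r := by
  set D := ENNReal.ofReal ((5 * (a + b) / b) ^ Module.finrank ℝ E)
  have hr1 : 0 < r - 1 := by linarith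
  -- The truncated masses are level-set measures of 2h for the measure h dx, so the layer-cake
  -- formula with exponent r - 1 sums them.
  have hI : ∫⁻ x, (2 * h x) ^ (r - 1) ∂(volume.withDensity h)
      = ENNReal.ofReal (2 ^ (r - 1)) * ∫⁻ x, h x ^ r := by
    rw [lintegral_withDensity_eq_lintegral_mul _ hh (by fun_prop),
      ← lintegral_const_mul' _ _ ENNReal.ofReal_ne_top]
    refine lintegral_congr fun x => ?_
    rw [Pi.mul_apply, ENNReal.mul_rpow_of_nonneg _ _ hr1.le, ← ENNReal.ofReal_rpow_of_pos two_pos,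
      ENNReal.ofReal_ofNat, mul_left_comm]
    congr 1
    conv_rhs => rw [show r = 1 + (r - 1) by ring, ENNReal.rpow_add_of_nonneg _ _ zero_le_one hr1.le,
      ENNReal.rpow_one]
  have hlc := lintegral_rpow_eq_lintegral_measure_lt (volume.withDensity h)
    (f := fun x => 2 * h x) (by fun_prop) hr1
  set J := ∫⁻ l in Ioi (0 : ℝ), ENNReal.ofReal l ^ (r - 1 - 1) *
      volume.withDensity h {x | ENNReal.ofReal l < 2 * h x}
  have hJ : J = ENNReal.ofReal (r - 1)⁻¹ * (ENNReal.ofReal (2 ^ (r - 1)) * ∫⁻ x, h x ^ r) := by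
    rw [← hI, hlc, ← mul_assoc, ← ENNReal.ofReal_mul (by positivity), inv_mul_cancel₀ hr1.ne',
      ENNReal.ofReal_one, one_mul]
  calc ∫⁻ x, ntMax a b h x ^ r
      = ENNReal.ofReal r * ∫⁻ l in Ioi (0 : ℝ), ENNReal.ofReal l ^ (r - 1) *
          volume {x | ENNReal.ofReal l < ntMax a b h x} :=
        lintegral_rpow_eq_lintegral_measure_lt volume (measurable_ntMax a b h) (by linarith)
    _ ≤ ENNReal.ofReal r * ∫⁻ l in Ioi (0 : ℝ), 2 * D * (ENNReal.ofReal l ^ (r - 1 - 1) *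
          volume.withDensity h {x | ENNReal.ofReal l < 2 * h x}) := by
        gcongr ENNReal.ofReal r * ?_
        refine setLIntegral_mono' measurableSet_Ioi fun l (hl : 0 < l) => ?_
        have hl0 : ENNReal.ofReal l ≠ 0 := by simpa using hl
        calc ENNReal.ofReal l ^ (r - 1) * volume {x | ENNReal.ofReal l < ntMax a b h x}
            = ENNReal.ofReal l ^ (r - 1 - 1) *
              (ENNReal.ofReal l * volume {x | ENNReal.ofReal l < ntMax a b h x}) := by
              rw [← mul_assoc]
              congr 1
              conv_rhs => rw [← ENNReal.rpow_one (ENNReal.ofReal l), ← ENNReal.rpow_mul, one_mul,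
                ← ENNReal.rpow_add _ _ hl0 ENNReal.ofReal_ne_top, sub_add_cancel]
          _ ≤ ENNReal.ofReal l ^ (r - 1 - 1) *
              (2 * D * volume.withDensity h {x | ENNReal.ofReal l < 2 * h x}) := by
              gcongr _ * ?_
              exact ofReal_mul_volume_lt_ntMax_le ha hb hh l
          _ = _ := by ring
    _ = ENNReal.ofReal r * (2 * D * J) := by
        rw [lintegral_const_mul' _ _ (by finiteness)]
    _ = ENNReal.ofReal r * ENNReal.ofReal 2 * ENNReal.ofReal (r - 1)⁻¹ *
          ENNReal.ofReal (2 ^ (r - 1)) * D * ∫⁻ x, h x ^ r := by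
        rw [hJ, ENNReal.ofReal_ofNat]
        ring
    _ = _ := by
        rw [← ENNReal.ofReal_mul (by positivity), ← ENNReal.ofReal_mul (by positivity),
          ← ENNReal.ofReal_mul (by positivity)]
        congr 3
        rw [Real.rpow_sub_one two_ne_zero]
        field_simp

end StrongType

/-! ### Duality for L^q without an a priori finiteness assumption. -/

/-- Monotone convergence along the truncations min(f, k) on the spanning sets, each of finite
integral. -/
theorem lintegral_le_of_forall_le {X : Type*} [MeasurableSpace X] {ν : Measure X} [SigmaFinite ν]
    {f : X → ℝ≥0∞} (hf : Measurable f) {A : ℝ≥0∞}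
    (h : ∀ u : X → ℝ≥0∞, Measurable u → u ≤ f → ∫⁻ x, u x ∂ν ≠ ∞ → ∫⁻ x, u x ∂ν ≤ A) :
    ∫⁻ x, f x ∂ν ≤ A := by
  set u : ℕ → X → ℝ≥0∞ := fun k => (spanningSets ν k).indicator fun x => min (f x) k with hu
  have hum : ∀ k, Measurable (u k) := fun k =>
    (hf.min measurable_const).indicator (measurableSet_spanningSets ν k)
  have huf : ∀ k, u k ≤ f := fun k =>
    indicator_le fun x _ => min_le_left _ _
  have hmono : Monotone u := by
    intro k l hkl
    refine (indicator_le_indicator_of_subset (monotone_spanningSets ν hkl)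
      fun _ => zero_le).trans ?_
    refine indicator_mono fun x => min_le_min le_rfl (by exact_mod_cast hkl)
  have hsup : ∀ x, f x = ⨆ k, u k x := by
    intro x
    refine le_antisymm (le_of_forall_lt fun c hc => ?_) (iSup_le fun k => huf k x)
    obtain ⟨m, hm⟩ := ENNReal.exists_nat_gt hc.ne_top
    obtain ⟨k, hk⟩ : ∃ k, x ∈ spanningSets ν k :=
      mem_iUnion.1 (iUnion_spanningSets ν ▸ mem_univ x)
    refine lt_of_lt_of_le ?_ (le_iSup _ (max k m))
    rw [hu]
    simp only
    rw [indicator_of_mem (monotone_spanningSets ν (le_max_left k m) hk)]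
    exact lt_min hc (hm.trans_le (by exact_mod_cast le_max_right k m))
  rw [lintegral_congr hsup, lintegral_iSup hum hmono]
  refine iSup_le fun k => h _ (hum k) (huf k) (ne_of_lt ?_)
  calc ∫⁻ x, u k x ∂ν ≤ ∫⁻ x, (spanningSets ν k).indicator (fun _ => (k : ℝ≥0∞)) x ∂ν :=
        lintegral_mono fun x => indicator_le_indicator (min_le_right _ _)
    _ = k * ν (spanningSets ν k) := lintegral_indicator_const (measurableSet_spanningSets ν k) _
    _ < ∞ := ENNReal.mul_lt_top (by simp) (measure_spanningSets_lt_top ν k)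

theorem lintegral_rpow_le_of_forall_mul_le {X : Type*} [MeasurableSpace X] {ν : Measure X}
    [SigmaFinite ν] {f : X → ℝ≥0∞} (hf : Measurable f) {q r : ℝ} (hqr : q.HolderConjugate r)
    {A : ℝ≥0∞}
    (h : ∀ u : X → ℝ≥0∞, Measurable u →
      ∫⁻ x, f x * u x ∂ν ≤ A ^ (1 / q) * (∫⁻ x, u x ^ r ∂ν) ^ (1 / r)) :
    ∫⁻ x, f x ^ q ∂ν ≤ A := by
  refine lintegral_le_of_forall_le (by fun_prop) fun u hu huf hfin => ?_
  -- For u ≤ f^q the test function u^{1/r} is extremal in Hölder's inequality: u ≤ f u^{1/r}.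
  -- Finiteness of ∫u then allows cancelling (∫u)^{1/r}.
  have h1 := h (fun x => u x ^ (1 / r)) (by fun_prop)
  simp only [one_div, ENNReal.rpow_inv_rpow hqr.symm.ne_zero] at h1
  have h2 : ∫⁻ x, u x ∂ν ≤ ∫⁻ x, f x * u x ^ r⁻¹ ∂ν := by
    refine lintegral_mono fun x => ?_
    calc u x = u x ^ q⁻¹ * u x ^ r⁻¹ := by
          rw [← ENNReal.rpow_add_of_nonneg _ _ hqr.inv_nonneg hqr.symm.inv_nonneg,
            hqr.inv_add_inv_eq_one, ENNReal.rpow_one]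
      _ ≤ f x * u x ^ r⁻¹ := by
          gcongr
          exact (ENNReal.rpow_inv_le_iff hqr.pos).2 (huf x)
  set I := ∫⁻ x, u x ∂ν
  rcases eq_or_ne I 0 with h0 | h0
  · simp [h0]
  have h3 : I ^ q⁻¹ * I ^ r⁻¹ ≤ A ^ q⁻¹ * I ^ r⁻¹ := by
    rw [← ENNReal.rpow_add_of_nonneg _ _ hqr.inv_nonneg hqr.symm.inv_nonneg,
      hqr.inv_add_inv_eq_one, ENNReal.rpow_one]
    exact h2.trans h1
  have h4 := (ENNReal.mul_le_mul_iff_left (ENNReal.rpow_pos (pos_iff_ne_zero.2 h0) hfin).ne'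
    (ENNReal.rpow_ne_top_of_nonneg hqr.symm.inv_nonneg hfin)).1 h3
  exact (ENNReal.rpow_le_rpow_iff hqr.inv_pos).1 h4

/-! ### Measures of cones and comparison of two apertures. -/

section Cone

section

variable {E : Type*} [NormedAddCommGroup E] [MeasureSpace E] [BorelSpace E]

/-- The measure of the cone `{(t, y) | |x - y| < a t}` with vertex `x` and aperture `a`. -/
noncomputable def coneMeasure (a : ℝ) (μ : Measure (ℝ × E)) (x : E) : ℝ≥0∞ :=
  μ {z | x ∈ Metric.ball z.2 (a * z.1)}

variable [SecondCountableTopology E]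

theorem measurableSet_mem_ball (a : ℝ) :
    MeasurableSet {w : E × ℝ × E | w.1 ∈ Metric.ball w.2.2 (a * w.2.1)} :=
  measurableSet_lt (f := fun w : E × ℝ × E => dist w.1 w.2.2) (g := fun w => a * w.2.1)
    (by fun_prop) (by fun_prop)

theorem measurableSet_cone (a : ℝ) (x : E) :
    MeasurableSet {z : ℝ × E | x ∈ Metric.ball z.2 (a * z.1)} :=
  measurable_prodMk_left (measurableSet_mem_ball a)

variable {μ : Measure (ℝ × E)} [SFinite μ]

theorem measurable_coneMeasure (a : ℝ) : Measurable (coneMeasure a μ) :=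
  measurable_measure_prodMk_left (measurableSet_mem_ball a)

theorem lintegral_coneMeasure_mul [SFinite (volume : Measure E)] (a : ℝ) {h : E → ℝ≥0∞}
    (hh : Measurable h) :
    ∫⁻ x, coneMeasure a μ x * h x = ∫⁻ z, (∫⁻ x in Metric.ball z.2 (a * z.1), h x) ∂μ := by
  have hm : Measurable fun w : E × ℝ × E =>
      {w : E × ℝ × E | w.1 ∈ Metric.ball w.2.2 (a * w.2.1)}.indicator (fun w => h w.1) w :=
    Measurable.indicator (by fun_prop) (measurableSet_mem_ball a)
  calc ∫⁻ x, coneMeasure a μ x * h x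
      = ∫⁻ x, (∫⁻ z, {w : E × ℝ × E | w.1 ∈ Metric.ball w.2.2 (a * w.2.1)}.indicator
          (fun w => h w.1) (x, z) ∂μ) := by
        refine lintegral_congr fun x => ?_
        rw [coneMeasure, mul_comm, ← lintegral_indicator_const (measurableSet_cone a x)]
        rfl
    _ = _ := by
        rw [lintegral_lintegral_swap hm.aemeasurable]
        refine lintegral_congr fun z => ?_
        rw [← lintegral_indicator measurableSet_ball]
        rfl

theorem setLIntegral_coneMeasure [SFinite (volume : Measure E)] (a : ℝ) {s : Set E}
    (hs : MeasurableSet s) :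
    ∫⁻ x in s, coneMeasure a μ x = ∫⁻ z, volume (Metric.ball z.2 (a * z.1) ∩ s) ∂μ := by
  have := lintegral_coneMeasure_mul (μ := μ) a (h := s.indicator 1) (measurable_one.indicator hs)
  rw [← lintegral_indicator hs]
  convert this using 3 with x z
  · by_cases hx : x ∈ s <;> simp [hx]
  · rw [lintegral_indicator_one hs, Measure.restrict_apply hs, inter_comm]

end

variable {E : Type*} [NormedAddCommGroup E] [NormedSpace ℝ E] [FiniteDimensional ℝ E]
  [MeasureSpace E] [BorelSpace E] [(volume : Measure E).IsAddHaarMeasure]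
  {μ : Measure (ℝ × E)} [SFinite μ]

theorem lintegral_coneMeasure_le {a b : ℝ} (ha : 0 < a) (hb : 0 < b) :
    ∫⁻ x, coneMeasure b μ x
      ≤ ENNReal.ofReal ((b / a) ^ Module.finrank ℝ E) * ∫⁻ x, coneMeasure a μ x := by
  have h1 := setLIntegral_coneMeasure (μ := μ) b (s := univ) .univ
  have h2 := setLIntegral_coneMeasure (μ := μ) a (s := univ) .univ
  simp only [Measure.restrict_univ, inter_univ] at h1 h2
  rw [h1, h2, ← lintegral_const_mul' _ _ ENNReal.ofReal_ne_top]
  exact lintegral_mono fun z => (volume_ball_mul ha hb z.2 z.2 z.1).le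

/-- A point of B(y, bt) outside the enlarged set witnesses that `O` fills at most half of B(y, at).
So at least half of B(y, at) lies outside `O`, and this half controls all of B(y, bt). If there is
no such point, the left side vanishes. -/
theorem volume_ball_diff_le {a b : ℝ} (ha : 0 < a) (hb : 0 < b) {O : Set E}
    (hO : MeasurableSet O) (t : ℝ) (y : E) :
    volume (Metric.ball y (b * t) ∩ {x | 1 / 2 < ntMax b a (O.indicator 1) x}ᶜ)
      ≤ 2 * ENNReal.ofReal ((b / a) ^ Module.finrank ℝ E) * volume (Metric.ball y (a * t) ∩ Oᶜ) := by
  rcases (Metric.ball y (b * t) ∩ {x | 1 / 2 < ntMax b a (O.indicator 1) x}ᶜ).eq_empty_or_nonempty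
    with he | ⟨x, hx, hxO⟩
  · rw [he, measure_empty]
    exact zero_le
  have h1 : (∫⁻ w in Metric.ball y (a * t), O.indicator 1 w) / volume (Metric.ball y (a * t))
      ≤ 1 / 2 := by
    by_contra hlt
    exact hxO (lt_ntMax_iff.2 ⟨(t, y), hx, not_le.1 hlt⟩)
  rw [lintegral_indicator_one hO, Measure.restrict_apply hO, inter_comm] at h1
  have ht : 0 < a * t := mul_pos ha (pos_of_mul_pos_right (Metric.nonempty_ball.1 ⟨x, hx⟩) hb.le)
  set V := volume (Metric.ball y (a * t)) with hV
  have hV0 : V ≠ 0 := (Metric.measure_ball_pos _ _ ht).ne'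
  have hVt : V ≠ ∞ := measure_ball_lt_top.ne
  rw [ENNReal.div_le_iff hV0 hVt] at h1
  have h2 : volume (Metric.ball y (a * t) ∩ O) + volume (Metric.ball y (a * t) ∩ Oᶜ) = V := by
    rw [← Set.sdiff_eq]
    exact measure_inter_add_sdiff _ hO
  have h3 : V ≤ 2 * volume (Metric.ball y (a * t) ∩ Oᶜ) := by
    have h4 : 1 / 2 * V + 1 / 2 * V ≤ 1 / 2 * V + volume (Metric.ball y (a * t) ∩ Oᶜ) := by
      rw [← add_mul, ENNReal.add_halves, one_mul]
      calc V = _ := h2.symm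
        _ ≤ _ := by gcongr
    have h5 := (ENNReal.add_le_add_iff_left (by finiteness)).1 h4
    calc V = 2 * (1 / 2 * V) := by
          rw [← mul_assoc, ENNReal.mul_div_cancel (by simp) (by simp), one_mul]
      _ ≤ _ := by gcongr
  calc volume (Metric.ball y (b * t) ∩ {x | 1 / 2 < ntMax b a (O.indicator 1) x}ᶜ)
      ≤ volume (Metric.ball y (b * t)) := measure_mono inter_subset_left
    _ = ENNReal.ofReal ((b / a) ^ Module.finrank ℝ E) * V := volume_ball_mul ha hb y y t
    _ ≤ ENNReal.ofReal ((b / a) ^ Module.finrank ℝ E) * (2 * volume (Metric.ball y (a * t) ∩ Oᶜ)) := by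
        gcongr
    _ = _ := by ring

/-- The enlarged set is absorbed by the weak type bound at height 1/2; on its complement Chebyshev's
inequality and Tonelli reduce the claim to `volume_ball_diff_le` for each (t, y). -/
theorem mul_volume_lt_coneMeasure_le {a b : ℝ} (ha : 0 < a) (hb : 0 < b) {O : Set E}
    (hO : MeasurableSet O) (l : ℝ≥0∞) :
    l * volume {x | l < coneMeasure b μ x}
      ≤ 2 * ENNReal.ofReal ((5 * (b + a) / a) ^ Module.finrank ℝ E) * (l * volume O)
        + 2 * ENNReal.ofReal ((b / a) ^ Module.finrank ℝ E) * ∫⁻ x in Oᶜ, coneMeasure a μ x := by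
  set S : Set E := {x | 1 / 2 < ntMax b a (O.indicator 1) x} with hS
  have hSm : MeasurableSet S := (isOpen_lt_ntMax _ _ _ _).measurableSet
  have h1 : volume S ≤ 2 * ENNReal.ofReal ((5 * (b + a) / a) ^ Module.finrank ℝ E) * volume O := by
    have := mul_volume_lt_ntMax_le hb ha (O.indicator (1 : E → ℝ≥0∞)) (1 / 2)
    rw [lintegral_indicator_one hO] at this
    calc volume S = 2 * (1 / 2 * volume S) := by
          rw [← mul_assoc, ENNReal.mul_div_cancel (by simp) (by simp), one_mul]
      _ ≤ _ := by rw [mul_assoc]; gcongr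
  have h2 : l * volume ({x | l < coneMeasure b μ x} ∩ Sᶜ)
      ≤ 2 * ENNReal.ofReal ((b / a) ^ Module.finrank ℝ E) * ∫⁻ x in Oᶜ, coneMeasure a μ x := by
    calc l * volume ({x | l < coneMeasure b μ x} ∩ Sᶜ)
        ≤ l * volume.restrict Sᶜ {x | l ≤ coneMeasure b μ x} := by
          rw [Measure.restrict_apply' hSm.compl]
          gcongr
          exact le_of_lt
      _ ≤ ∫⁻ x in Sᶜ, coneMeasure b μ x := mul_meas_ge_le_lintegral (measurable_coneMeasure b) l
      _ ≤ _ := by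
          rw [setLIntegral_coneMeasure _ hSm.compl, setLIntegral_coneMeasure _ hO.compl,
            ← lintegral_const_mul' _ _ (by finiteness)]
          exact lintegral_mono fun z => volume_ball_diff_le ha hb hO z.1 z.2
  calc l * volume {x | l < coneMeasure b μ x}
      ≤ l * (volume S + volume ({x | l < coneMeasure b μ x} ∩ Sᶜ)) := by
        gcongr
        refine (measure_mono fun x hx => ?_).trans (measure_union_le _ _)
        by_cases hxS : x ∈ S
        · exact Or.inl hxS
        · exact Or.inr ⟨hx, hxS⟩
    _ ≤ l * (2 * ENNReal.ofReal ((5 * (b + a) / a) ^ Module.finrank ℝ E) * volume O) +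
          2 * ENNReal.ofReal ((b / a) ^ Module.finrank ℝ E) * ∫⁻ x in Oᶜ, coneMeasure a μ x := by
        rw [mul_add]
        gcongr
    _ = _ := by ring

/-- The mean of `h` over B(y, bt) is at most the maximal function at every point of B(y, at). Thus
the mass of `h` on the first ball is at most the volume ratio times the integral of the maximal
function over the second. -/
theorem lintegral_coneMeasure_mul_le {a b : ℝ} (ha : 0 < a) (hb : 0 < b) {h : E → ℝ≥0∞}
    (hh : Measurable h) :
    ∫⁻ x, coneMeasure b μ x * h x
      ≤ ENNReal.ofReal ((b / a) ^ Module.finrank ℝ E) * ∫⁻ x, coneMeasure a μ x * ntMax a b h x := by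
  rw [lintegral_coneMeasure_mul b hh, lintegral_coneMeasure_mul a (measurable_ntMax a b h),
    ← lintegral_const_mul' _ _ ENNReal.ofReal_ne_top]
  refine lintegral_mono fun z => ?_
  rcases le_or_gt z.1 0 with ht | ht
  · simp [Metric.ball_eq_empty.2 (mul_nonpos_of_nonneg_of_nonpos hb.le ht)]
  set m := (∫⁻ x in Metric.ball z.2 (b * z.1), h x) / volume (Metric.ball z.2 (b * z.1)) with hm
  have hV0 : volume (Metric.ball z.2 (b * z.1)) ≠ 0 :=
    (Metric.measure_ball_pos _ _ (mul_pos hb ht)).ne'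
  calc ∫⁻ x in Metric.ball z.2 (b * z.1), h x
      = m * volume (Metric.ball z.2 (b * z.1)) :=
        (ENNReal.div_mul_cancel hV0 measure_ball_lt_top.ne).symm
    _ = ENNReal.ofReal ((b / a) ^ Module.finrank ℝ E) * ∫⁻ x in Metric.ball z.2 (a * z.1), m := by
        rw [volume_ball_mul ha hb z.2 z.2, setLIntegral_const]
        ring
    _ ≤ _ := by
        gcongr ENNReal.ofReal _ * ?_
        exact setLIntegral_mono' measurableSet_ball fun x hx =>
          le_iSup₂_of_le z hx le_rfl

end Cone

/-! ### The change of aperture in L^q, for all q > 0. -/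

section ChangeOfAperture

variable {E : Type*} [NormedAddCommGroup E] [NormedSpace ℝ E] [FiniteDimensional ℝ E]
  [MeasureSpace E] [BorelSpace E] [(volume : Measure E).IsAddHaarMeasure]

theorem five_mul_add_div_pow_le {a b : ℝ} (ha : 0 < a) (hb : 0 < b) (k : ℕ) :
    (5 * (b + a) / a) ^ k ≤ 10 ^ k * max 1 ((b / a) ^ k) := by
  have hba : 0 < b / a := div_pos hb ha
  have h1 : 5 * (b + a) / a = 5 * (b / a) + 5 := by field_simp
  rw [h1]
  rcases le_total (b / a) 1 with h | h
  · calc (5 * (b / a) + 5) ^ k ≤ 10 ^ k := by gcongr; linarith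
      _ ≤ _ := le_mul_of_one_le_right (by positivity) (le_max_left _ _)
  · calc (5 * (b / a) + 5) ^ k ≤ (10 * (b / a)) ^ k := by gcongr; linarith
      _ = 10 ^ k * (b / a) ^ k := mul_pow _ _ _
      _ ≤ _ := by gcongr; exact le_max_right _ _

theorem lintegral_mul_rpow_sub_one_le {X : Type*} [MeasurableSpace X] (ν : Measure X)
    (f : X → ℝ≥0∞) {q c : ℝ} (hq : q < 1) (hc : 0 < c) :
    ∫⁻ x, f x * (ENNReal.ofReal c * f x) ^ (q - 1) ∂ν
      ≤ ENNReal.ofReal (c ^ (q - 1)) * ∫⁻ x, f x ^ q ∂ν := by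
  rw [← lintegral_const_mul' _ _ ENNReal.ofReal_ne_top]
  refine lintegral_mono fun x => ?_
  rcases eq_or_ne (f x) 0 with h0 | h0
  · simp [h0]
  rcases eq_or_ne (f x) ∞ with ht | ht
  · rw [ht, ENNReal.mul_top (by simpa using hc), ENNReal.top_rpow_of_neg (by linarith), mul_zero]
    exact zero_le
  · rw [ENNReal.mul_rpow_of_ne_top ENNReal.ofReal_ne_top ht, ENNReal.ofReal_rpow_of_pos hc,
      mul_left_comm]
    gcongr
    conv_lhs => rw [← ENNReal.rpow_one (f x), ← ENNReal.rpow_mul, one_mul,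
      ← ENNReal.rpow_add _ _ h0 ht]
    rw [show 1 + (q - 1) = q by ring]

theorem ofReal_rpow_sub_two_mul {l : ℝ} (hl : 0 < l) (q : ℝ) :
    ENNReal.ofReal l ^ (q - 2) * ENNReal.ofReal l = ENNReal.ofReal l ^ (q - 1) := by
  have hl0 : ENNReal.ofReal l ≠ 0 := by simpa using hl
  conv_lhs => rw [← ENNReal.rpow_one (ENNReal.ofReal l), ← ENNReal.rpow_mul, one_mul,
    ← ENNReal.rpow_add _ _ hl0 ENNReal.ofReal_ne_top]
  rw [show q - 2 + 1 = q - 1 by ring]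

/-- The level-set estimate with O = {c F_a > l}, multiplied by l^{q-2} and integrated in l. The free
parameter `c` is kept for balancing the two terms. -/
theorem lintegral_coneMeasure_rpow_le_of_lt_one {μ : Measure (ℝ × E)} [SFinite μ] {a b : ℝ}
    (ha : 0 < a) (hb : 0 < b) {q c : ℝ} (hq : 0 < q) (hq1 : q < 1) (hc : 0 < c) :
    ∫⁻ x, coneMeasure b μ x ^ q
      ≤ ENNReal.ofReal (2 * (5 * (b + a) / a) ^ Module.finrank ℝ E * c ^ q +
          2 * q / (1 - q) * (b / a) ^ Module.finrank ℝ E * c ^ (q - 1)) *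
        ∫⁻ x, coneMeasure a μ x ^ q := by
  have hq1' : 0 < 1 - q := by linarith
  set D : ℝ := (5 * (b + a) / a) ^ Module.finrank ℝ E with hD
  set κ : ℝ := (b / a) ^ Module.finrank ℝ E with hκ
  have hDpos : 0 < D := by positivity
  have hκpos : 0 < κ := by positivity
  have hFm : Measurable (coneMeasure a μ) := measurable_coneMeasure a
  set G : E → ℝ≥0∞ := fun x => ENNReal.ofReal c * coneMeasure a μ x with hG
  have hGm : Measurable G := hFm.const_mul _
  set ν := (volume : Measure E).withDensity (coneMeasure a μ) with hν
  have hpt : ∀ l : ℝ, 0 < l →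
      ENNReal.ofReal l ^ (q - 1) * volume {x | ENNReal.ofReal l < coneMeasure b μ x} ≤
        2 * ENNReal.ofReal D *
          (ENNReal.ofReal l ^ (q - 1) * volume {x | ENNReal.ofReal l < G x}) +
        2 * ENNReal.ofReal κ *
          (ENNReal.ofReal l ^ (q - 2) * ν {x | G x ≤ ENNReal.ofReal l}) := by
    intro l hl
    have hO : MeasurableSet {x | ENNReal.ofReal l < G x} := measurableSet_lt (by fun_prop) hGm
    have hc' : {x | ENNReal.ofReal l < G x}ᶜ = {x | G x ≤ ENNReal.ofReal l} := by
      ext x; simp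
    have := mul_volume_lt_coneMeasure_le (μ := μ) ha hb hO (ENNReal.ofReal l)
    rw [← withDensity_apply _ hO.compl, hc'] at this
    calc ENNReal.ofReal l ^ (q - 1) * volume {x | ENNReal.ofReal l < coneMeasure b μ x}
        = ENNReal.ofReal l ^ (q - 2) *
          (ENNReal.ofReal l * volume {x | ENNReal.ofReal l < coneMeasure b μ x}) := by
          rw [← mul_assoc, ofReal_rpow_sub_two_mul hl]
      _ ≤ ENNReal.ofReal l ^ (q - 2) *
          (2 * ENNReal.ofReal D * (ENNReal.ofReal l * volume {x | ENNReal.ofReal l < G x}) +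
            2 * ENNReal.ofReal κ * ν {x | G x ≤ ENNReal.ofReal l}) := by
          gcongr _ * ?_
      _ = _ := by
          rw [← ofReal_rpow_sub_two_mul hl]
          ring
  -- Splitting the integral needs measurability of one summand only; here it follows from
  -- monotonicity of the distribution function.
  have hmeas : Measurable fun l : ℝ => 2 * ENNReal.ofReal D *
      (ENNReal.ofReal l ^ (q - 1) * volume {x | ENNReal.ofReal l < G x}) := by
    refine Measurable.const_mul (Measurable.mul (by fun_prop) ?_) _
    refine Antitone.measurable fun l m hlm => measure_mono fun x hx => ?_
    exact (ENNReal.ofReal_le_ofReal hlm).trans_lt hx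
  have hGq : ∫⁻ x, G x ^ q = ENNReal.ofReal (c ^ q) * ∫⁻ x, coneMeasure a μ x ^ q := by
    rw [← lintegral_const_mul' _ _ ENNReal.ofReal_ne_top]
    refine lintegral_congr fun x => ?_
    rw [hG, ENNReal.mul_rpow_of_nonneg _ _ hq.le, ENNReal.ofReal_rpow_of_pos hc]
  have hGν : ∫⁻ x, G x ^ (q - 1) ∂ν
      ≤ ENNReal.ofReal (c ^ (q - 1)) * ∫⁻ x, coneMeasure a μ x ^ q := by
    rw [hν, lintegral_withDensity_eq_lintegral_mul _ hFm (hGm.pow_const _)]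
    exact lintegral_mul_rpow_sub_one_le _ _ hq1 hc
  calc ∫⁻ x, coneMeasure b μ x ^ q
      = ENNReal.ofReal q * ∫⁻ l in Ioi (0 : ℝ), ENNReal.ofReal l ^ (q - 1) *
          volume {x | ENNReal.ofReal l < coneMeasure b μ x} :=
        lintegral_rpow_eq_lintegral_measure_lt volume (measurable_coneMeasure b) hq
    _ ≤ ENNReal.ofReal q * ∫⁻ l in Ioi (0 : ℝ), (2 * ENNReal.ofReal D *
          (ENNReal.ofReal l ^ (q - 1) * volume {x | ENNReal.ofReal l < G x}) +
          2 * ENNReal.ofReal κ *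
          (ENNReal.ofReal l ^ (q - 2) * ν {x | G x ≤ ENNReal.ofReal l})) := by
        gcongr ENNReal.ofReal q * ?_
        exact setLIntegral_mono' measurableSet_Ioi hpt
    _ = 2 * ENNReal.ofReal D * (ENNReal.ofReal q * ∫⁻ l in Ioi (0 : ℝ),
          (ENNReal.ofReal l ^ (q - 1) * volume {x | ENNReal.ofReal l < G x})) +
        ENNReal.ofReal q * (2 * ENNReal.ofReal κ) * ∫⁻ l in Ioi (0 : ℝ),
          (ENNReal.ofReal l ^ (q - 2) * ν {x | G x ≤ ENNReal.ofReal l}) := by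
        rw [lintegral_add_left hmeas, lintegral_const_mul' _ _ (by finiteness),
          lintegral_const_mul' _ _ (by finiteness)]
        ring
    _ ≤ 2 * ENNReal.ofReal D * (ENNReal.ofReal (c ^ q) * ∫⁻ x, coneMeasure a μ x ^ q) +
        ENNReal.ofReal q * (2 * ENNReal.ofReal κ) * (ENNReal.ofReal (1 - q)⁻¹ *
          (ENNReal.ofReal (c ^ (q - 1)) * ∫⁻ x, coneMeasure a μ x ^ q)) := by
        rw [← lintegral_rpow_eq_lintegral_measure_lt volume hGm hq, hGq]
        gcongr _ + _ * ?_
        exact (lintegral_rpow_mul_measure_le ν hGm hq1).trans (by gcongr)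
    _ = (ENNReal.ofReal 2 * ENNReal.ofReal D * ENNReal.ofReal (c ^ q) +
          ENNReal.ofReal q * (ENNReal.ofReal 2 * ENNReal.ofReal κ) * ENNReal.ofReal (1 - q)⁻¹ *
            ENNReal.ofReal (c ^ (q - 1))) * ∫⁻ x, coneMeasure a μ x ^ q := by
        rw [ENNReal.ofReal_ofNat]
        ring
    _ = _ := by
        rw [← ENNReal.ofReal_mul (by positivity), ← ENNReal.ofReal_mul (by positivity),
          ← ENNReal.ofReal_mul (by positivity), ← ENNReal.ofReal_mul (by positivity),
          ← ENNReal.ofReal_mul (by positivity), ← ENNReal.ofReal_mul (by positivity),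
          ← ENNReal.ofReal_add (by positivity) (by positivity)]
        congr 3
        field_simp

theorem lintegral_coneMeasure_rpow_le_of_one_lt {μ : Measure (ℝ × E)} [SFinite μ] {a b : ℝ}
    (ha : 0 < a) (hb : 0 < b) {q r : ℝ} (hqr : q.HolderConjugate r) :
    ∫⁻ x, coneMeasure b μ x ^ q
      ≤ ENNReal.ofReal (((b / a) ^ Module.finrank ℝ E) ^ q *
          (2 ^ r * r / (r - 1) * (5 * (a + b) / b) ^ Module.finrank ℝ E) ^ (q - 1)) *
        ∫⁻ x, coneMeasure a μ x ^ q := by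
  have hr1 : 0 < r - 1 := sub_pos.2 hqr.symm.lt
  have hr0 : 0 < r := hqr.symm.pos
  have hq0 : 0 < q := hqr.pos
  set κ : ℝ := (b / a) ^ Module.finrank ℝ E with hκ
  set B : ℝ := 2 ^ r * r / (r - 1) * (5 * (a + b) / b) ^ Module.finrank ℝ E with hB
  have hκpos : 0 < κ := by positivity
  have hBpos : 0 < B := by positivity
  set I := ∫⁻ x, coneMeasure a μ x ^ q with hI
  refine lintegral_rpow_le_of_forall_mul_le (measurable_coneMeasure b) hqr fun h hh => ?_
  -- Since (q - 1)/q = 1/r, this root is κ times the maximal operator bound B^{1/r} times the L^q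
  -- norm.
  have hA : (ENNReal.ofReal (κ ^ q * B ^ (q - 1)) * I) ^ (1 / q)
      = ENNReal.ofReal κ * ENNReal.ofReal B ^ (1 / r) * I ^ (1 / q) := by
    rw [ENNReal.mul_rpow_of_nonneg _ _ (by positivity),
      ENNReal.ofReal_rpow_of_pos (by positivity), ENNReal.ofReal_rpow_of_pos hBpos,
      ← ENNReal.ofReal_mul hκpos.le, Real.mul_rpow (by positivity) (by positivity),
      ← Real.rpow_mul hκpos.le, ← Real.rpow_mul hBpos.le, mul_one_div_cancel hq0.ne',
      Real.rpow_one]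
    congr 4
    have := hqr.inv_add_inv_eq_one
    rw [← eq_sub_iff_add_eq'] at this
    rw [one_div r, this]
    field_simp
  rw [hA]
  calc ∫⁻ x, coneMeasure b μ x * h x
      ≤ ENNReal.ofReal κ * ∫⁻ x, coneMeasure a μ x * ntMax a b h x :=
        lintegral_coneMeasure_mul_le ha hb hh
    _ ≤ ENNReal.ofReal κ * (I ^ (1 / q) * (∫⁻ x, ntMax a b h x ^ r) ^ (1 / r)) := by
        gcongr ENNReal.ofReal _ * ?_
        exact ENNReal.lintegral_mul_le_Lp_mul_Lq volume hqr
          (measurable_coneMeasure a).aemeasurable (measurable_ntMax a b h).aemeasurable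
    _ ≤ ENNReal.ofReal κ * (I ^ (1 / q) * (ENNReal.ofReal B * ∫⁻ x, h x ^ r) ^ (1 / r)) := by
        gcongr
        rw [hB, ENNReal.ofReal_mul (by positivity)]
        exact lintegral_ntMax_rpow_le ha hb hh hqr.symm.lt
    _ = _ := by
        rw [ENNReal.mul_rpow_of_nonneg _ _ (by positivity)]
        ring

variable (E) in
theorem exists_lintegral_coneMeasure_rpow_le {q : ℝ} (hq : 0 < q) :
    ∃ C : ℝ, 0 < C ∧ ∀ a b : ℝ, 0 < a → 0 < b → ∀ (μ : Measure (ℝ × E)) [SFinite μ],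
      ∫⁻ x, coneMeasure b μ x ^ q
        ≤ ENNReal.ofReal (C * max (((b / a) ^ Module.finrank ℝ E) ^ q)
            ((b / a) ^ Module.finrank ℝ E)) * ∫⁻ x, coneMeasure a μ x ^ q := by
  rcases lt_trichotomy q 1 with hq1 | rfl | hq1
  · have hq1' : 0 < 1 - q := by linarith
    refine ⟨2 * 10 ^ Module.finrank ℝ E + 2 * q / (1 - q), by positivity, fun a b ha hb μ _ => ?_⟩
    have hD := five_mul_add_div_pow_le ha hb (Module.finrank ℝ E)
    set κ : ℝ := (b / a) ^ Module.finrank ℝ E with hκ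
    have hκpos : 0 < κ := by positivity
    have hM : 0 < max 1 κ := by positivity
    -- The choice c = κ / max(1, κ) = min(1, κ) makes max(1, κ) c^q and κ c^{q-1} both equal to
    -- max(κ^q, κ).
    refine (lintegral_coneMeasure_rpow_le_of_lt_one ha hb hq hq1 (div_pos hκpos hM)).trans ?_
    rw [← hκ]
    gcongr ENNReal.ofReal ?_ * _
    have h1 : max 1 κ * (κ / max 1 κ) ^ q = max (κ ^ q) κ ∧
        κ * (κ / max 1 κ) ^ (q - 1) = max (κ ^ q) κ := by
      rcases le_total κ 1 with h | h
      · have h2 : κ ≤ κ ^ q := by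
          simpa using Real.rpow_le_rpow_of_exponent_ge hκpos h hq1.le
        rw [max_eq_left h, max_eq_left h2, Real.rpow_sub_one (by positivity)]
        constructor
        · simp
        · field_simp
      · have h2 : κ ^ q ≤ κ := by
          simpa using Real.rpow_le_rpow_of_exponent_le h hq1.le
        rw [max_eq_right h, max_eq_right h2, div_self hκpos.ne']
        simp
    calc 2 * (5 * (b + a) / a) ^ Module.finrank ℝ E * (κ / max 1 κ) ^ q +
          2 * q / (1 - q) * κ * (κ / max 1 κ) ^ (q - 1)
        ≤ 2 * (10 ^ Module.finrank ℝ E * max 1 κ) * (κ / max 1 κ) ^ q +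
          2 * q / (1 - q) * κ * (κ / max 1 κ) ^ (q - 1) := by gcongr
      _ = 2 * 10 ^ Module.finrank ℝ E * (max 1 κ * (κ / max 1 κ) ^ q) +
          2 * q / (1 - q) * (κ * (κ / max 1 κ) ^ (q - 1)) := by ring
      _ = _ := by rw [h1.1, h1.2]; ring
  · refine ⟨1, one_pos, fun a b ha hb μ _ => ?_⟩
    simpa using lintegral_coneMeasure_le (μ := μ) ha hb
  · have hqr := Real.HolderConjugate.conjExponent hq1
    set r := q.conjExponent
    have hr1 : 0 < r - 1 := sub_pos.2 hqr.symm.lt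
    have hr0 : 0 < r := hqr.symm.pos
    refine ⟨(2 ^ r * r / (r - 1) * 10 ^ Module.finrank ℝ E) ^ (q - 1), by positivity,
      fun a b ha hb μ _ => ?_⟩
    refine (lintegral_coneMeasure_rpow_le_of_one_lt ha hb hqr).trans ?_
    have hD := five_mul_add_div_pow_le hb ha (Module.finrank ℝ E)
    have hinv : (a / b) ^ Module.finrank ℝ E = ((b / a) ^ Module.finrank ℝ E)⁻¹ := by
      rw [← inv_pow, inv_div]
    rw [hinv] at hD
    set κ : ℝ := (b / a) ^ Module.finrank ℝ E with hκ
    have hκpos : 0 < κ := by positivity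
    gcongr ENNReal.ofReal ?_ * _
    -- The maximal constant is of order max(1, 1/κ); for κ ≤ 1 it lowers κ^q · κ^{-(q-1)} to exactly
    -- κ.
    have h1 : κ ^ q * (max 1 κ⁻¹) ^ (q - 1) = max (κ ^ q) κ := by
      rcases le_total κ 1 with h | h
      · have h2 : κ ^ q ≤ κ := by
          simpa using Real.rpow_le_rpow_of_exponent_ge hκpos h hq1.le
        rw [max_eq_right ((one_le_inv₀ hκpos).2 h), max_eq_right h2, Real.inv_rpow hκpos.le,
          ← Real.rpow_neg hκpos.le, ← Real.rpow_add hκpos]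
        simp
      · have h2 : κ ≤ κ ^ q := by
          simpa using Real.rpow_le_rpow_of_exponent_le h hq1.le
        rw [max_eq_left (inv_le_one_of_one_le₀ h), max_eq_left h2]
        simp
    calc κ ^ q * (2 ^ r * r / (r - 1) * (5 * (a + b) / b) ^ Module.finrank ℝ E) ^ (q - 1)
        ≤ κ ^ q * (2 ^ r * r / (r - 1) * (10 ^ Module.finrank ℝ E * max 1 κ⁻¹)) ^ (q - 1) := by
          gcongr
      _ = (2 ^ r * r / (r - 1) * 10 ^ Module.finrank ℝ E) ^ (q - 1) *
          (κ ^ q * (max 1 κ⁻¹) ^ (q - 1)) := by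
          rw [← mul_assoc, Real.mul_rpow (by positivity) (by positivity)]
          ring
      _ = _ := by rw [h1]

end ChangeOfAperture

/-! ### Arithmetic of the comparison factors. -/

section Exponents

theorem expo_two (n : ℕ) : expo n 2 = n / 2 := by
  simp [expo, div_eq_mul_inv]

theorem expo_le_expo (n : ℕ) {p p' : ℝ≥0∞} (hp : 0 < p) (h : p ≤ p') :
    expo n p' ≤ expo n p := by
  unfold expo
  gcongr
  · simpa using hp.ne'

theorem hUpper_pos (n : ℕ) (p : ℝ≥0∞) {ρ : ℝ} (hρ : 0 < ρ) : 0 < hUpper n p ρ :=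
  lt_max_of_lt_left (Real.rpow_pos_of_pos hρ _)

theorem hLower_pos (n : ℕ) (p : ℝ≥0∞) {ρ : ℝ} (hρ : 0 < ρ) : 0 < hLower n p ρ :=
  lt_min (Real.rpow_pos_of_pos hρ _) (Real.rpow_pos_of_pos hρ _)

theorem hLower_mul_hUpper_inv_le (n : ℕ) (p : ℝ≥0∞) {ρ : ℝ} (hρ : 0 < ρ) :
    hLower n p ρ * hUpper n p ρ⁻¹ ≤ 1 := by
  unfold hLower hUpper
  rw [Real.inv_rpow hρ.le, Real.inv_rpow hρ.le]
  have h1 := Real.rpow_pos_of_pos hρ (-expo n 2)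
  have h2 := Real.rpow_pos_of_pos hρ (-expo n p)
  rcases le_total (ρ ^ (-expo n 2))⁻¹ (ρ ^ (-expo n p))⁻¹ with h | h
  · rw [max_eq_right h]
    calc _ ≤ ρ ^ (-expo n p) * (ρ ^ (-expo n p))⁻¹ := by gcongr; exact min_le_right _ _
      _ = 1 := mul_inv_cancel₀ h2.ne'
  · rw [max_eq_left h]
    calc _ ≤ ρ ^ (-expo n 2) * (ρ ^ (-expo n 2))⁻¹ := by gcongr; exact min_le_left _ _
      _ = 1 := mul_inv_cancel₀ h1.ne'

theorem hUpper_inv_le_rpow (n : ℕ) {p : ℝ≥0∞} (hp : 0 < p) {ρ : ℝ} (hρ : 1 ≤ ρ) :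
    hUpper n p ρ⁻¹ ≤ ρ ^ expo n (min 2 p) := by
  have hρ0 : 0 ≤ ρ := by linarith
  have hm : 0 < min 2 p := lt_min two_pos hp
  unfold hUpper
  rw [Real.inv_rpow hρ0, Real.inv_rpow hρ0, ← Real.rpow_neg hρ0, ← Real.rpow_neg hρ0, neg_neg,
    neg_neg]
  exact max_le (Real.rpow_le_rpow_of_exponent_le hρ (expo_le_expo n hm (min_le_left _ _)))
    (Real.rpow_le_rpow_of_exponent_le hρ (expo_le_expo n hm (min_le_right _ _)))

theorem hUpper_le_rpow (n : ℕ) {p : ℝ≥0∞} (hp : 0 < p) {ρ : ℝ} (hρ : 1 ≤ ρ) :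
    hUpper n p ρ ≤ ρ ^ (-expo n (max 2 p)) :=
  max_le
    (Real.rpow_le_rpow_of_exponent_le hρ (neg_le_neg (expo_le_expo n two_pos (le_max_left _ _))))
    (Real.rpow_le_rpow_of_exponent_le hρ (neg_le_neg (expo_le_expo n hp (le_max_right _ _))))

theorem div_rpow_neg_expo {a b : ℝ} (ha : 0 < a) (hb : 0 < b) (n : ℕ) (s : ℝ) :
    (a / b) ^ (-(n * s)) = ((b / a) ^ n) ^ s := by
  rw [← inv_div, Real.inv_rpow (by positivity), ← Real.rpow_neg (by positivity), neg_neg,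
    Real.rpow_mul (by positivity), Real.rpow_natCast]

end Exponents

/-! ### The upper estimate for the tent space norms, including the Carleson endpoint. -/

section Norms

variable {n : ℕ}

/-- The measure `t⁻ⁿ |g(t, y)|² dy dt / t` on the upper half-space. -/
noncomputable def squareMeasure (g : ℝ × EuclideanSpace ℝ (Fin n) → ℂ) :
    Measure (ℝ × EuclideanSpace ℝ (Fin n)) :=
  (volume.restrict (upperHalfSpace n)).withDensity fun z =>
    1 / ENNReal.ofReal z.1 ^ n * ‖g z‖ₑ ^ 2 / ENNReal.ofReal z.1

instance (g : ℝ × EuclideanSpace ℝ (Fin n) → ℂ) : SFinite (squareMeasure g) := by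
  unfold squareMeasure; infer_instance

theorem areaFunctional_eq_coneMeasure (α : ℝ) (g : ℝ × EuclideanSpace ℝ (Fin n) → ℂ) :
    areaFunctional α g = fun x => coneMeasure α (squareMeasure g) x ^ (1 / 2 : ℝ) := by
  ext x
  rw [areaFunctional, coneMeasure, squareMeasure, withDensity_apply _ (measurableSet_cone α x),
    ← lintegral_indicator (measurableSet_cone α x)]
  congr 1
  refine lintegral_congr fun z => ?_
  by_cases hz : z.2 ∈ Metric.ball x (α * z.1)
  · rw [indicator_of_mem hz, indicator_of_mem (by exact Metric.mem_ball_comm.1 hz)]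
  · rw [indicator_of_notMem hz, indicator_of_notMem
      (by exact fun h => hz (Metric.mem_ball_comm.1 h))]
    simp

theorem tentNorm_of_ne_top {p : ℝ≥0∞} (hp : p ≠ 0) (hpt : p ≠ ∞) (α : ℝ)
    (g : ℝ × EuclideanSpace ℝ (Fin n) → ℂ) :
    tentNorm p α g
      = (∫⁻ x, coneMeasure α (squareMeasure g) x ^ (p.toReal / 2)) ^ (1 / p.toReal) := by
  rw [tentNorm, if_neg hpt, eLpNorm_eq_lintegral_rpow_enorm_toReal hp hpt,
    areaFunctional_eq_coneMeasure]
  congr 1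
  refine lintegral_congr fun x => ?_
  rw [enorm_eq_self, ← ENNReal.rpow_mul]
  congr 1
  ring

theorem exists_tentNorm_le_of_ne_top (n : ℕ) {p : ℝ≥0∞} (hp : 0 < p) (hpt : p ≠ ∞) :
    ∃ C : ℝ, 0 < C ∧ ∀ α β : ℝ, 0 < α → 0 < β → ∀ g : ℝ × EuclideanSpace ℝ (Fin n) → ℂ,
      tentNorm p β g ≤ ENNReal.ofReal (C * hUpper n p (α / β)) * tentNorm p α g := by
  have hp' : 0 < p.toReal := ENNReal.toReal_pos hp.ne' hpt
  obtain ⟨C, hC, h⟩ := exists_lintegral_coneMeasure_rpow_le (EuclideanSpace ℝ (Fin n))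
    (half_pos hp')
  refine ⟨C ^ (1 / p.toReal), by positivity, fun α β hα hβ g => ?_⟩
  have hκ : 0 < (β / α) ^ n := by positivity
  have hU : C ^ (1 / p.toReal) * hUpper n p (α / β)
      = (C * max (((β / α) ^ n) ^ (p.toReal / 2)) ((β / α) ^ n)) ^ (1 / p.toReal) := by
    rw [Real.mul_rpow hC.le (by positivity), hUpper, expo_two, expo, div_eq_mul_inv (n : ℝ) 2,
      div_rpow_neg_expo hα hβ, div_rpow_neg_expo hα hβ, ENNReal.toReal_inv,
      (Real.monotoneOn_rpow_Ici_of_exponent_nonneg (r := 1 / p.toReal) (by positivity)).map_max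
        (by rw [mem_Ici]; positivity) (by rw [mem_Ici]; positivity), ← Real.rpow_mul hκ.le, one_div]
    congr 3
    field_simp
  rw [tentNorm_of_ne_top hp.ne' hpt, tentNorm_of_ne_top hp.ne' hpt, hU,
    ← ENNReal.ofReal_rpow_of_pos (by positivity), ← ENNReal.mul_rpow_of_nonneg _ _ (by positivity)]
  gcongr
  simpa using h α β hα hβ (squareMeasure g)

/-- Points of the β-tent have t < r/β, so the loss αt stays below αr/β, the amount by which the
radius is enlarged. -/
theorem tent_subset_tent {α β : ℝ} (hα : 0 < α) (hβ : 0 < β) (x : EuclideanSpace ℝ (Fin n))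
    {r : ℝ} (hr : 0 < r) : tent β x r ⊆ tent α x ((1 + α / β) * r) := by
  rintro z ⟨hz0, hzr, hz⟩
  rw [lt_div_iff₀ hβ] at hzr
  rw [Metric.mem_ball] at hz
  have h1 : (1 + α / β) * r = r + α * (r / β) := by field_simp
  have h2 : z.1 < r / β := (lt_div_iff₀ hβ).2 hzr
  refine ⟨hz0, ?_, ?_⟩
  · rw [lt_div_iff₀ hα, h1]
    nlinarith
  · rw [Metric.mem_ball, h1]
    nlinarith [mul_pos hβ hz0]

theorem carlesonNorm_le {α β : ℝ} (hα : 0 < α) (hβ : 0 < β)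
    (g : ℝ × EuclideanSpace ℝ (Fin n) → ℂ) :
    carlesonNorm β g ≤ ENNReal.ofReal (2 ^ n * hUpper n ∞ (α / β)) * carlesonNorm α g := by
  set U := hUpper n ∞ (α / β) with hU
  have hUpos : 0 < U := hUpper_pos n ∞ (div_pos hα hβ)
  -- Dilating the ball by 1 + α/β and renormalizing by (β/α)ⁿ costs (1 + β/α)ⁿ. As U² = max((β/α)ⁿ,
  -- 1), this is at most 2ⁿU².
  have hK : (1 + β / α) ^ n ≤ (2 ^ n * U) ^ 2 := by
    have hU2 : U = max (((β / α) ^ n) ^ (1 / 2 : ℝ)) 1 := by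
      rw [hU, hUpper, expo_two, div_eq_mul_inv (n : ℝ) 2, div_rpow_neg_expo hα hβ]
      simp [expo]
    have hU1 : 1 ≤ U := hU2 ▸ le_max_right _ _
    have hba : 0 < β / α := div_pos hβ hα
    have hU3 : (β / α) ^ n ≤ U ^ 2 := by
      calc (β / α) ^ n = (((β / α) ^ n) ^ (1 / 2 : ℝ)) ^ 2 := by
            rw [← Real.sqrt_eq_rpow, Real.sq_sqrt (by positivity)]
        _ ≤ U ^ 2 := by
            gcongr
            exact hU2 ▸ le_max_left _ _
    have h4 : (1 + β / α) ^ n ≤ 2 ^ n * U ^ 2 := by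
      rcases le_total (β / α) 1 with h | h
      · calc (1 + β / α) ^ n ≤ 2 ^ n := by gcongr; linarith
          _ ≤ _ := le_mul_of_one_le_right (by positivity) (one_le_pow₀ hU1)
      · calc (1 + β / α) ^ n ≤ (2 * (β / α)) ^ n := by gcongr; linarith
          _ = 2 ^ n * (β / α) ^ n := mul_pow _ _ _
          _ ≤ _ := by gcongr
    calc _ ≤ 2 ^ n * U ^ 2 := h4
      _ ≤ (2 ^ n) ^ 2 * U ^ 2 := by
          gcongr
          exact le_self_pow₀ (one_le_pow₀ one_le_two) two_ne_zero
      _ = _ := by ring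
  set K := ENNReal.ofReal (2 ^ n * U) with hKdef
  have hK0 : K ≠ 0 := by
    rw [hKdef, Ne, ENNReal.ofReal_eq_zero, not_le]; positivity
  rw [← ENNReal.div_le_iff' hK0 ENNReal.ofReal_ne_top]
  refine le_sInf fun C hC => ENNReal.div_le_of_le_mul' (sInf_le fun x r hr => ?_)
  have hvol : volume (Metric.ball x ((1 + α / β) * r)) / ENNReal.ofReal α ^ n
      = ENNReal.ofReal ((1 + β / α) ^ n) * (volume (Metric.ball x r) / ENNReal.ofReal β ^ n) := by
    rw [volume_ball_mul one_pos (by positivity) x x r, one_mul, div_one, finrank_euclideanSpace_fin,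
      ← ENNReal.ofReal_pow hα.le, ← ENNReal.ofReal_pow hβ.le, ← mul_div_assoc, mul_comm,
      mul_div_assoc, ← ENNReal.ofReal_div_of_pos (by positivity), mul_comm (ENNReal.ofReal _),
      mul_div_assoc (volume _), ← ENNReal.ofReal_div_of_pos (by positivity), ← div_pow, ← div_pow]
    congr 3
    field_simp
    ring
  calc ∫⁻ z in tent β x r, ‖g z‖ₑ ^ 2 / ENNReal.ofReal z.1
      ≤ ∫⁻ z in tent α x ((1 + α / β) * r), ‖g z‖ₑ ^ 2 / ENNReal.ofReal z.1 :=
        lintegral_mono_set (tent_subset_tent hα hβ x hr)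
    _ ≤ C ^ 2 * (volume (Metric.ball x ((1 + α / β) * r)) / ENNReal.ofReal α ^ n) :=
        hC x _ (by positivity)
    _ ≤ C ^ 2 * (K ^ 2 * (volume (Metric.ball x r) / ENNReal.ofReal β ^ n)) := by
        rw [hvol, hKdef, ← ENNReal.ofReal_pow (p := 2 ^ n * U) (by positivity)]
        gcongr
    _ = _ := by ring

theorem exists_tentNorm_le (n : ℕ) {p : ℝ≥0∞} (hp : 0 < p) :
    ∃ C : ℝ, 0 < C ∧ ∀ α β : ℝ, 0 < α → 0 < β → ∀ g : ℝ × EuclideanSpace ℝ (Fin n) → ℂ,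
      tentNorm p β g ≤ ENNReal.ofReal (C * hUpper n p (α / β)) * tentNorm p α g := by
  rcases eq_or_ne p ∞ with rfl | hpt
  · refine ⟨2 ^ n, by positivity, fun α β hα hβ g => ?_⟩
    simpa [tentNorm] using carlesonNorm_le hα hβ g
  · exact exists_tentNorm_le_of_ne_top n hp hpt

end Norms

/-! ### Extremal functions: indicators of boxes. -/

section Box

variable {n : ℕ}

/-- The Whitney-type box `(1, 2) × B(0, R)` in the upper half-space. -/
def box (n : ℕ) (R : ℝ) : Set (ℝ × EuclideanSpace ℝ (Fin n)) :=
  Ioo 1 2 ×ˢ Metric.ball 0 R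

theorem measurableSet_box (n : ℕ) (R : ℝ) : MeasurableSet (box n R) :=
  measurableSet_Ioo.prod measurableSet_ball

/-- The indicator function of `(1, 2) × B(0, R)`. -/
noncomputable def boxFunction (n : ℕ) (R : ℝ) : ℝ × EuclideanSpace ℝ (Fin n) → ℂ :=
  (box n R).indicator fun _ => 1

variable (n) in
theorem volume_ball_eq_ofReal (x : EuclideanSpace ℝ (Fin n)) {r : ℝ} (hr : 0 < r) :
    volume (Metric.ball x r)
      = ENNReal.ofReal (r ^ n * (volume (Metric.ball (0 : EuclideanSpace ℝ (Fin n)) 1)).toReal) := by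
  rw [Measure.addHaar_ball_of_pos _ _ hr, finrank_euclideanSpace_fin,
    ENNReal.ofReal_mul (by positivity), ENNReal.ofReal_toReal measure_ball_lt_top.ne]

theorem volume_Ioo_prod_ball (x : EuclideanSpace ℝ (Fin n)) (r : ℝ) :
    volume (Ioo (1 : ℝ) 2 ×ˢ Metric.ball x r) = volume (Metric.ball x r) := by
  rw [Measure.volume_eq_prod, Measure.prod_prod, Real.volume_Ioo]
  norm_num

theorem locallySquareIntegrable_boxFunction (n : ℕ) (R : ℝ) :
    LocallySquareIntegrable (boxFunction n R) := fun K _ _ =>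
  (memLp_indicator_const 2 (measurableSet_box n R) (1 : ℂ) (Or.inr (by
    rw [box, volume_Ioo_prod_ball]; exact measure_ball_lt_top.ne))).restrict K

theorem enorm_boxFunction_sq (R : ℝ) (z : ℝ × EuclideanSpace ℝ (Fin n)) :
    ‖boxFunction n R z‖ₑ ^ 2 = (box n R).indicator 1 z := by
  by_cases hz : z ∈ box n R <;> simp [boxFunction, hz]

theorem one_le_ofReal_fst {R : ℝ} {z : ℝ × EuclideanSpace ℝ (Fin n)} (hz : z ∈ box n R) :
    1 ≤ ENNReal.ofReal z.1 := ENNReal.one_le_ofReal.2 hz.1.1.le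

theorem ofReal_fst_le_two {R : ℝ} {z : ℝ × EuclideanSpace ℝ (Fin n)} (hz : z ∈ box n R) :
    ENNReal.ofReal z.1 ≤ 2 := by
  simpa using ENNReal.ofReal_le_ofReal hz.1.2.le

theorem squareMeasure_boxFunction_le (R : ℝ) {S : Set (ℝ × EuclideanSpace ℝ (Fin n))}
    (hS : MeasurableSet S) : squareMeasure (boxFunction n R) S ≤ volume (box n R ∩ S) := by
  rw [squareMeasure, withDensity_apply _ hS, ← Measure.restrict_apply (measurableSet_box n R),
    ← lintegral_indicator_one (measurableSet_box n R)]
  refine (lintegral_mono' (Measure.restrict_mono le_rfl Measure.restrict_le_self) le_rfl).trans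
    (lintegral_mono fun z => ?_)
  simp only [enorm_boxFunction_sq]
  by_cases hz : z ∈ box n R
  · have h1 := one_le_ofReal_fst hz
    simp only [indicator_of_mem hz, Pi.one_apply, mul_one]
    exact ENNReal.div_le_of_le_mul (by
      rw [one_mul]
      exact (ENNReal.div_le_of_le_mul (by rw [one_mul]; exact one_le_pow₀ h1)).trans h1)
  · simp [indicator_of_notMem hz]

theorem le_squareMeasure_boxFunction (R : ℝ) {S : Set (ℝ × EuclideanSpace ℝ (Fin n))}
    (hS : MeasurableSet S) :
    ENNReal.ofReal ((1 / 2) ^ (n + 1)) * volume (box n R ∩ S)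
      ≤ squareMeasure (boxFunction n R) S := by
  have hsub : box n R ∩ S ⊆ S ∩ upperHalfSpace n := fun z hz => ⟨hz.2, one_pos.trans hz.1.1.1⟩
  rw [squareMeasure, withDensity_apply _ hS, Measure.restrict_restrict hS]
  calc ENNReal.ofReal ((1 / 2) ^ (n + 1)) * volume (box n R ∩ S)
      = ∫⁻ z in box n R ∩ S, ENNReal.ofReal ((1 / 2) ^ (n + 1)) := (setLIntegral_const _ _).symm
    _ ≤ ∫⁻ z in box n R ∩ S, 1 / ENNReal.ofReal z.1 ^ n * ‖boxFunction n R z‖ₑ ^ 2 /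
          ENNReal.ofReal z.1 := by
        refine setLIntegral_mono' ((measurableSet_box n R).inter hS) fun z hz => ?_
        have h2 := ofReal_fst_le_two hz.1
        rw [enorm_boxFunction_sq, indicator_of_mem hz.1, Pi.one_apply, mul_one,
          ENNReal.ofReal_pow (by norm_num), pow_succ, one_div, one_div,
          ENNReal.ofReal_inv_of_pos two_pos, ENNReal.ofReal_ofNat, div_eq_mul_inv,
          ← ENNReal.inv_pow]
        gcongr
    _ ≤ _ := lintegral_mono_set hsub

/-- Heights are below 2, so a point of the box seen from `x` lies within 2α of `x` and within R of
0. These constraints bound the mass by a ball of radius 2 min(α, R) and force |x| < 2α + R ≤ 3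
max(α, R). -/
theorem coneMeasure_boxFunction_le {α R : ℝ} (hα : 0 < α) (hR : 0 < R)
    (x : EuclideanSpace ℝ (Fin n)) :
    coneMeasure α (squareMeasure (boxFunction n R)) x ≤
      (Metric.ball (0 : EuclideanSpace ℝ (Fin n)) (3 * max α R)).indicator
        (fun _ => volume (Metric.ball (0 : EuclideanSpace ℝ (Fin n)) (2 * min α R))) x := by
  refine (squareMeasure_boxFunction_le R (measurableSet_cone α x)).trans ?_
  have hdist : ∀ z ∈ box n R ∩ {z | x ∈ Metric.ball z.2 (α * z.1)},
      dist x z.2 < 2 * α ∧ dist z.2 0 < R := by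
    rintro z ⟨⟨⟨-, ht⟩, hy⟩, hx⟩
    refine ⟨(Metric.mem_ball.1 hx).trans ?_, hy⟩
    nlinarith
  by_cases hx : x ∈ Metric.ball (0 : EuclideanSpace ℝ (Fin n)) (3 * max α R)
  · rw [indicator_of_mem hx]
    rcases le_total α R with h | h
    · rw [min_eq_left h, ← Measure.addHaar_ball_center _ x, ← volume_Ioo_prod_ball]
      exact measure_mono fun z hz => ⟨hz.1.1, Metric.mem_ball_comm.1 (hdist z hz).1⟩
    · rw [min_eq_right h, ← volume_Ioo_prod_ball]
      refine measure_mono fun z hz => ⟨hz.1.1, Metric.mem_ball.2 ?_⟩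
      linarith [(hdist z hz).2]
  · rw [indicator_of_notMem hx, nonpos_iff_eq_zero]
    suffices h : box n R ∩ {z | x ∈ Metric.ball z.2 (α * z.1)} = ∅ by rw [h, measure_empty]
    refine eq_empty_iff_forall_notMem.2 fun z hz => ?_
    obtain ⟨h1, h2⟩ := hdist z hz
    refine hx (Metric.mem_ball.2 ((dist_triangle x z.2 0).trans_lt ?_))
    linarith [le_max_left α R, le_max_right α R]

/-- Heights exceed 1, so `x` sees every y in the base with |x - y| < α. For α ≤ R this includes B(x,
α/2), which stays in B(0, R); for R ≤ α it includes B(0, R/2). The power of 1/2 bounds the weight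
t^{-n-1} below. -/
theorem le_coneMeasure_boxFunction {α R : ℝ} (hα : 0 < α) (hR : 0 < R)
    (x : EuclideanSpace ℝ (Fin n)) :
    (Metric.ball (0 : EuclideanSpace ℝ (Fin n)) (1 / 2 * max α R)).indicator
        (fun _ => ENNReal.ofReal ((1 / 2) ^ (n + 1)) *
          volume (Metric.ball (0 : EuclideanSpace ℝ (Fin n)) (1 / 2 * min α R))) x
      ≤ coneMeasure α (squareMeasure (boxFunction n R)) x := by
  refine le_trans ?_ (le_squareMeasure_boxFunction R (measurableSet_cone α x))
  by_cases hx : x ∈ Metric.ball (0 : EuclideanSpace ℝ (Fin n)) (1 / 2 * max α R)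
  · rw [indicator_of_mem hx]
    gcongr _ * ?_
    rw [Metric.mem_ball] at hx
    rcases le_total α R with h | h
    · rw [min_eq_left h, ← Measure.addHaar_ball_center _ x, ← volume_Ioo_prod_ball]
      rw [max_eq_right h] at hx
      refine measure_mono fun z hz => ⟨⟨hz.1, Metric.mem_ball.2 ?_⟩, Metric.mem_ball.2 ?_⟩
      · have := Metric.mem_ball.1 hz.2
        linarith [dist_triangle z.2 x 0]
      · have := Metric.mem_ball.1 hz.2
        rw [dist_comm]
        nlinarith [hz.1.1]
    · rw [min_eq_right h, ← volume_Ioo_prod_ball]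
      rw [max_eq_left h] at hx
      refine measure_mono fun z hz => ⟨⟨hz.1, Metric.mem_ball.2 ?_⟩, Metric.mem_ball.2 ?_⟩
      · have := Metric.mem_ball.1 hz.2
        linarith
      · have := Metric.mem_ball.1 hz.2
        have h1 := dist_triangle x 0 z.2
        rw [dist_comm 0 z.2] at h1
        nlinarith [hz.1.1]
  · rw [indicator_of_notMem hx]
    exact zero_le

/-- The size of the tent space norms of the indicator function of `(1, 2) × B(0, R)`. -/
noncomputable def boxProfile (n : ℕ) (p : ℝ≥0∞) (α R : ℝ) : ℝ :=
  min α R ^ expo n 2 * max α R ^ expo n p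

theorem boxProfile_pos (n : ℕ) (p : ℝ≥0∞) {α R : ℝ} (hα : 0 < α) (hR : 0 < R) :
    0 < boxProfile n p α R :=
  mul_pos (Real.rpow_pos_of_pos (lt_min hα hR) _) (Real.rpow_pos_of_pos (lt_max_of_lt_left hα) _)

theorem mul_boxProfile_eq (n : ℕ) {p : ℝ≥0∞} (hp : 0 < p.toReal) {A B α R : ℝ} (hA : 0 < A)
    (hB : 0 < B) (hα : 0 < α) (hR : 0 < R) :
    A ^ (1 / 2 : ℝ) * B ^ (1 / p.toReal) * boxProfile n p α R
      = ((A * min α R ^ n) ^ (p.toReal / 2) * (B * max α R ^ n)) ^ (1 / p.toReal) := by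
  have hm : 0 < min α R := lt_min hα hR
  have hM : 0 < max α R := lt_max_of_lt_left hα
  rw [Real.mul_rpow (by positivity) (by positivity), ← Real.rpow_mul (by positivity),
    Real.mul_rpow hA.le (by positivity), Real.mul_rpow hB.le (by positivity), boxProfile, expo_two,
    expo, ENNReal.toReal_inv, ← Real.rpow_natCast, ← Real.rpow_natCast, ← Real.rpow_mul hm.le,
    ← Real.rpow_mul hM.le]
  have h1 : p.toReal / 2 * (1 / p.toReal) = 1 / 2 := by field_simp
  rw [h1, mul_one_div, one_div p.toReal]
  ring

theorem lintegral_indicator_const_rpow {X : Type*} [MeasurableSpace X] (ν : Measure X) {s : Set X}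
    (hs : MeasurableSet s) (c : ℝ≥0∞) {q : ℝ} (hq : 0 < q) :
    ∫⁻ x, s.indicator (fun _ => c) x ^ q ∂ν = c ^ q * ν s := by
  rw [← lintegral_indicator_const hs]
  refine lintegral_congr fun x => ?_
  by_cases hx : x ∈ s <;> simp [hx, hq]

theorem exists_tentNorm_boxFunction_of_ne_top (n : ℕ) {p : ℝ≥0∞} (hp : 0 < p) (hpt : p ≠ ∞) :
    ∃ c C : ℝ, 0 < c ∧ 0 < C ∧ ∀ α R : ℝ, 0 < α → 0 < R →
      ENNReal.ofReal (c * boxProfile n p α R) ≤ tentNorm p α (boxFunction n R) ∧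
      tentNorm p α (boxFunction n R) ≤ ENNReal.ofReal (C * boxProfile n p α R) := by
  have hp' : 0 < p.toReal := ENNReal.toReal_pos hp.ne' hpt
  set w : ℝ := (volume (Metric.ball (0 : EuclideanSpace ℝ (Fin n)) 1)).toReal with hw
  have hwpos : 0 < w :=
    ENNReal.toReal_pos (Metric.measure_ball_pos _ _ one_pos).ne' measure_ball_lt_top.ne
  refine ⟨((1 / 2) ^ (n + 1) * ((1 / 2) ^ n * w)) ^ (1 / 2 : ℝ) *
      ((1 / 2) ^ n * w) ^ (1 / p.toReal),
    (2 ^ n * w) ^ (1 / 2 : ℝ) * (3 ^ n * w) ^ (1 / p.toReal), by positivity, by positivity,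
    fun α R hα hR => ?_⟩
  have hm : 0 < min α R := lt_min hα hR
  have hM : 0 < max α R := lt_max_of_lt_left hα
  rw [mul_boxProfile_eq n hp' (by positivity) (by positivity) hα hR,
    mul_boxProfile_eq n hp' (by positivity) (by positivity) hα hR, tentNorm_of_ne_top hp.ne' hpt,
    ← ENNReal.ofReal_rpow_of_pos (by positivity), ← ENNReal.ofReal_rpow_of_pos (by positivity)]
  constructor
  · gcongr
    calc ENNReal.ofReal (((1 / 2) ^ (n + 1) * ((1 / 2) ^ n * w) * min α R ^ n) ^ (p.toReal / 2) *
          ((1 / 2) ^ n * w * max α R ^ n))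
        = ∫⁻ x, (Metric.ball (0 : EuclideanSpace ℝ (Fin n)) (1 / 2 * max α R)).indicator
            (fun _ => ENNReal.ofReal ((1 / 2) ^ (n + 1)) * volume (Metric.ball
              (0 : EuclideanSpace ℝ (Fin n)) (1 / 2 * min α R))) x ^ (p.toReal / 2) := by
          rw [lintegral_indicator_const_rpow _ measurableSet_ball _ (by positivity),
            volume_ball_eq_ofReal n 0 (r := 1 / 2 * min α R) (by positivity),
            volume_ball_eq_ofReal n 0 (r := 1 / 2 * max α R) (by positivity), ← hw,
            ← ENNReal.ofReal_mul (by positivity), ENNReal.ofReal_rpow_of_pos (by positivity),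
            ← ENNReal.ofReal_mul (by positivity)]
          congr 1
          rw [mul_pow, mul_pow]
          ring_nf
      _ ≤ _ := by
          gcongr with x
          exact le_coneMeasure_boxFunction hα hR x
  · gcongr
    calc ∫⁻ x, coneMeasure α (squareMeasure (boxFunction n R)) x ^ (p.toReal / 2)
        ≤ ∫⁻ x, (Metric.ball (0 : EuclideanSpace ℝ (Fin n)) (3 * max α R)).indicator
            (fun _ => volume (Metric.ball (0 : EuclideanSpace ℝ (Fin n)) (2 * min α R))) x
              ^ (p.toReal / 2) := by
          gcongr with x
          exact coneMeasure_boxFunction_le hα hR x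
      _ = _ := by
          rw [lintegral_indicator_const_rpow _ measurableSet_ball _ (by positivity),
            volume_ball_eq_ofReal n 0 (r := 2 * min α R) (by positivity),
            volume_ball_eq_ofReal n 0 (r := 3 * max α R) (by positivity), ← hw,
            ENNReal.ofReal_rpow_of_pos (by positivity), ← ENNReal.ofReal_mul (by positivity)]
          congr 1
          rw [mul_pow, mul_pow]
          ring_nf

/-- A tent with r ≤ α has height at most 1 and misses the box. Otherwise its slices lie in B(x, r),
which suffices for α ≤ R; for R ≤ α the whole box has volume (R/r)ⁿ|B(x, r)|, and r > α. -/
theorem setLIntegral_boxFunction_le {α R r : ℝ} (hα : 0 < α) (hR : 0 < R) (hr : 0 < r)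
    (x : EuclideanSpace ℝ (Fin n)) :
    ∫⁻ z in tent α x r, ‖boxFunction n R z‖ₑ ^ 2 / ENNReal.ofReal z.1
      ≤ ENNReal.ofReal ((min α R / α) ^ n) * volume (Metric.ball x r) := by
  have hle : ∀ z, ‖boxFunction n R z‖ₑ ^ 2 / ENNReal.ofReal z.1 ≤ (box n R).indicator 1 z := by
    intro z
    rw [enorm_boxFunction_sq]
    by_cases hz : z ∈ box n R
    · rw [indicator_of_mem hz]
      exact ENNReal.div_le_of_le_mul (by simpa using one_le_ofReal_fst hz)
    · simp [indicator_of_notMem hz]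
  refine (lintegral_mono hle).trans ?_
  rw [lintegral_indicator_one (measurableSet_box n R),
    Measure.restrict_apply (measurableSet_box n R)]
  rcases le_or_gt r α with h | h
  · suffices h : box n R ∩ tent α x r = ∅ by
      rw [h, measure_empty]
      exact zero_le
    refine eq_empty_iff_forall_notMem.2 ?_
    rintro z ⟨hz, -, hzr, -⟩
    rw [lt_div_iff₀ hα] at hzr
    nlinarith [hz.1.1]
  · rcases le_total α R with h' | h'
    · rw [min_eq_left h', div_self hα.ne', one_pow, ENNReal.ofReal_one, one_mul,
        ← volume_Ioo_prod_ball]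
      refine measure_mono ?_
      rintro z ⟨hz, hz0, -, hzx⟩
      exact ⟨hz.1, Metric.ball_subset_ball (by nlinarith) hzx⟩
    · rw [min_eq_right h']
      calc volume (box n R ∩ tent α x r) ≤ volume (box n R) := measure_mono inter_subset_left
        _ = ENNReal.ofReal ((R / r) ^ n) * volume (Metric.ball x r) := by
          have := volume_ball_mul hr hR (0 : EuclideanSpace ℝ (Fin n)) x 1
          rwa [mul_one, mul_one, finrank_euclideanSpace_fin, ← volume_Ioo_prod_ball] at this
        _ ≤ _ := by gcongr

theorem le_setLIntegral_boxFunction {α : ℝ} (hα : 0 < α) (R : ℝ) :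
    ENNReal.ofReal (1 / 2) * volume (Metric.ball (0 : EuclideanSpace ℝ (Fin n)) R)
      ≤ ∫⁻ z in tent α 0 (4 * max α R), ‖boxFunction n R z‖ₑ ^ 2 / ENNReal.ofReal z.1 := by
  -- At heights t < 2 the slice of this tent has radius 4 max(α, R) - αt, more than R.
  have hsub : box n R ⊆ tent α 0 (4 * max α R) := by
    rintro z ⟨⟨h1, h2⟩, hy⟩
    have h3 := le_max_left α R
    have h4 := le_max_right α R
    refine ⟨one_pos.trans h1, ?_, Metric.ball_subset_ball ?_ hy⟩
    · rw [lt_div_iff₀ hα]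
      nlinarith
    · nlinarith
  rw [← volume_Ioo_prod_ball]
  calc ENNReal.ofReal (1 / 2) * volume (box n R)
      = ∫⁻ z in box n R, ENNReal.ofReal (1 / 2) := (setLIntegral_const _ _).symm
    _ ≤ ∫⁻ z in box n R, ‖boxFunction n R z‖ₑ ^ 2 / ENNReal.ofReal z.1 := by
        refine setLIntegral_mono' (measurableSet_box n R) fun z hz => ?_
        have h2 := ofReal_fst_le_two hz
        rw [enorm_boxFunction_sq, indicator_of_mem hz, Pi.one_apply, one_div,
          ENNReal.ofReal_inv_of_pos two_pos, ENNReal.ofReal_ofNat, one_div]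
        gcongr
    _ ≤ _ := lintegral_mono_set hsub

theorem carlesonNorm_boxFunction {α R : ℝ} (hα : 0 < α) (hR : 0 < R) :
    ENNReal.ofReal ((1 / 2) ^ (n + 1) * boxProfile n ∞ α R) ≤ carlesonNorm α (boxFunction n R) ∧
      carlesonNorm α (boxFunction n R) ≤ ENNReal.ofReal (1 * boxProfile n ∞ α R) := by
  have hm : 0 < min α R := lt_min hα hR
  have hM : 0 < max α R := lt_max_of_lt_left hα
  have hprof : boxProfile n ∞ α R ^ 2 = min α R ^ n := by
    rw [boxProfile, expo_two]
    simp only [expo, ENNReal.inv_top, ENNReal.toReal_zero, mul_zero, Real.rpow_zero, mul_one]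
    rw [← Real.rpow_natCast, ← Real.rpow_mul hm.le, ← Real.rpow_natCast]
    congr 1
    push_cast
    ring
  have hpos : 0 < boxProfile n ∞ α R := boxProfile_pos n ∞ hα hR
  constructor
  · refine le_sInf fun C hC => ?_
    have h1 := (le_setLIntegral_boxFunction hα R).trans (hC 0 (4 * max α R) (by positivity))
    rw [← ENNReal.pow_le_pow_left_iff two_ne_zero, ← ENNReal.ofReal_pow (by positivity), mul_pow,
      hprof]
    have hV := volume_ball_mul hR (b := 4 * max α R) (by positivity)
      (0 : EuclideanSpace ℝ (Fin n)) 0 1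
    rw [mul_one, mul_one, finrank_euclideanSpace_fin] at hV
    set V := volume (Metric.ball (0 : EuclideanSpace ℝ (Fin n)) R)
    have hV0 : V ≠ 0 := (Metric.measure_ball_pos _ _ hR).ne'
    have hVt : V ≠ ∞ := measure_ball_lt_top.ne
    set K : ℝ := (4 * max α R / R) ^ n / α ^ n with hK
    have hKpos : 0 < K := by positivity
    rw [hV, mul_comm (ENNReal.ofReal ((4 * max α R / R) ^ n)) V, mul_div_assoc,
      ← ENNReal.ofReal_pow hα.le,
      ← ENNReal.ofReal_div_of_pos (by positivity), ← hK, mul_comm V, ← mul_assoc,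
      ENNReal.mul_le_mul_iff_left hV0 hVt] at h1
    refine le_trans ?_ (ENNReal.div_le_of_le_mul h1)
    rw [← ENNReal.ofReal_div_of_pos hKpos]
    gcongr
    -- Uses min(α, R) · max(α, R) = αR.
    have hK' : K = (4 / min α R) ^ n := by
      rw [hK, ← div_pow]
      congr 1
      have := min_mul_max α R
      field_simp
      linarith
    calc ((1 / 2 : ℝ) ^ (n + 1)) ^ 2 * min α R ^ n = 1 / 4 * (min α R / 4) ^ n := by
          rw [← pow_mul, mul_comm (n + 1) 2, pow_mul, pow_succ, div_eq_mul_inv (min α R), mul_pow]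
          norm_num
          ring
      _ ≤ 1 / 2 * (min α R / 4) ^ n := by gcongr; norm_num
      _ = 1 / 2 / K := by rw [hK', div_eq_mul_inv (1 / 2 : ℝ), ← inv_pow, inv_div]
  · refine sInf_le fun x r hr => ?_
    refine (setLIntegral_boxFunction_le hα hR hr x).trans (le_of_eq ?_)
    rw [one_mul, ← ENNReal.ofReal_pow hpos.le, hprof, div_pow,
      ENNReal.ofReal_div_of_pos (by positivity), ENNReal.ofReal_pow hα.le]
    simp only [div_eq_mul_inv]
    ring

theorem exists_tentNorm_boxFunction (n : ℕ) {p : ℝ≥0∞} (hp : 0 < p) :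
    ∃ c C : ℝ, 0 < c ∧ 0 < C ∧ ∀ α R : ℝ, 0 < α → 0 < R →
      ENNReal.ofReal (c * boxProfile n p α R) ≤ tentNorm p α (boxFunction n R) ∧
      tentNorm p α (boxFunction n R) ≤ ENNReal.ofReal (C * boxProfile n p α R) := by
  rcases eq_or_ne p ∞ with rfl | hpt
  · refine ⟨(1 / 2) ^ (n + 1), 1, by positivity, one_pos, fun α R hα hR => ?_⟩
    simpa only [tentNorm, if_true] using carlesonNorm_boxFunction hα hR
  · exact exists_tentNorm_boxFunction_of_ne_top n hp hpt

/-- R = max(α, β) makes the minimum equal to the aperture and the maximum independent of it, so only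
the power n/2 is felt; R = min(α, β) exchanges the roles and leaves n/p. -/
theorem exists_boxProfile_eq (n : ℕ) (p : ℝ≥0∞) {α β : ℝ} (hα : 0 < α) (hβ : 0 < β) {h : ℝ}
    (hh : h = (α / β) ^ (-expo n 2) ∨ h = (α / β) ^ (-expo n p)) :
    ∃ R, 0 < R ∧ boxProfile n p β R = h * boxProfile n p α R := by
  have key : ∀ s : ℝ, β ^ s = (α / β) ^ (-s) * α ^ s := by
    intro s
    rw [Real.rpow_neg (by positivity), ← Real.inv_rpow (by positivity), inv_div,
      ← Real.mul_rpow (by positivity) hα.le, div_mul_cancel₀ _ hα.ne']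
  rcases hh with rfl | rfl
  · refine ⟨max α β, lt_max_of_lt_left hα, ?_⟩
    rw [boxProfile, boxProfile, min_eq_left (le_max_left α β), min_eq_left (le_max_right α β),
      max_eq_right (le_max_left α β), max_eq_right (le_max_right α β), key]
    ring
  · refine ⟨min α β, lt_min hα hβ, ?_⟩
    rw [boxProfile, boxProfile, min_eq_right (min_le_left α β), min_eq_right (min_le_right α β),
      max_eq_left (min_le_left α β), max_eq_left (min_le_right α β), key (expo n p)]
    ring

/-- Both powers of `α / β` occur as ratios of the norms of a function. -/
theorem exists_tentNorm_comparable (n : ℕ) {p : ℝ≥0∞} (hp : 0 < p) :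
    ∃ c c' : ℝ, 0 < c ∧ 0 < c' ∧ ∀ α β : ℝ, 0 < α → 0 < β → ∀ h : ℝ,
      (h = (α / β) ^ (-expo n 2) ∨ h = (α / β) ^ (-expo n p)) →
      ∃ g : ℝ × EuclideanSpace ℝ (Fin n) → ℂ, LocallySquareIntegrable g ∧
        0 < tentNorm p α g ∧ tentNorm p α g < ∞ ∧
        tentNorm p β g ≤ ENNReal.ofReal (c * h) * tentNorm p α g ∧
        ENNReal.ofReal (c' * h) * tentNorm p α g ≤ tentNorm p β g := by
  obtain ⟨c, C, hc, hC, hbox⟩ := exists_tentNorm_boxFunction n hp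
  refine ⟨C / c, c / C, by positivity, by positivity, fun α β hα hβ h hh => ?_⟩
  have hh0 : 0 < h := by
    rcases hh with rfl | rfl <;> positivity
  obtain ⟨R, hR, hprof⟩ := exists_boxProfile_eq n p hα hβ hh
  have hpos := boxProfile_pos n p hα hR
  refine ⟨boxFunction n R, locallySquareIntegrable_boxFunction n R, ?_, ?_, ?_, ?_⟩
  · exact (ENNReal.ofReal_pos.2 (by positivity)).trans_le (hbox α R hα hR).1
  · exact (hbox α R hα hR).2.trans_lt ENNReal.ofReal_lt_top
  · calc tentNorm p β (boxFunction n R) ≤ ENNReal.ofReal (C * boxProfile n p β R) :=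
          (hbox β R hβ hR).2
      _ = ENNReal.ofReal (C / c * h) * ENNReal.ofReal (c * boxProfile n p α R) := by
          rw [← ENNReal.ofReal_mul (by positivity), hprof]
          congr 1
          field_simp
      _ ≤ _ := by
          gcongr
          exact (hbox α R hα hR).1
  · calc ENNReal.ofReal (c / C * h) * tentNorm p α (boxFunction n R)
        ≤ ENNReal.ofReal (c / C * h) * ENNReal.ofReal (C * boxProfile n p α R) := by
          gcongr
          exact (hbox α R hα hR).2
      _ = ENNReal.ofReal (c * boxProfile n p β R) := by
          rw [← ENNReal.ofReal_mul (by positivity), hprof]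
          congr 1
          field_simp
      _ ≤ _ := (hbox β R hβ hR).1

end Box

end TentSpace

/-! ### The theorem. -/

theorem theorem1 (n : ℕ) (p : ℝ≥0∞) (hp : 0 < p) :
    -- the two-sided estimate
    (∃ C C' : ℝ, 0 < C ∧ 0 < C' ∧
      ∀ α β : ℝ, 0 < α → 0 < β →
      ∀ g : ℝ × EuclideanSpace ℝ (Fin n) → ℂ, TentSpace.LocallySquareIntegrable g →
        ENNReal.ofReal (C * TentSpace.hLower n p (α / β)) * TentSpace.tentNorm p α g
            ≤ TentSpace.tentNorm p β g ∧
        TentSpace.tentNorm p β g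
            ≤ ENNReal.ofReal (C' * TentSpace.hUpper n p (α / β)) * TentSpace.tentNorm p α g) ∧
    -- both bounds are attained, up to a constant, for each pair of apertures
    (∃ c c' : ℝ, 0 < c ∧ 0 < c' ∧
      ∀ α β : ℝ, 0 < α → 0 < β →
        (∃ g : ℝ × EuclideanSpace ℝ (Fin n) → ℂ, TentSpace.LocallySquareIntegrable g ∧
          0 < TentSpace.tentNorm p α g ∧ TentSpace.tentNorm p α g < ∞ ∧
          TentSpace.tentNorm p β g
            ≤ ENNReal.ofReal (c * TentSpace.hLower n p (α / β)) * TentSpace.tentNorm p α g) ∧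
        (∃ g : ℝ × EuclideanSpace ℝ (Fin n) → ℂ, TentSpace.LocallySquareIntegrable g ∧
          0 < TentSpace.tentNorm p α g ∧ TentSpace.tentNorm p α g < ∞ ∧
          ENNReal.ofReal (c' * TentSpace.hUpper n p (α / β)) * TentSpace.tentNorm p α g
            ≤ TentSpace.tentNorm p β g)) ∧
    -- the two estimates for apertures `α > 1` and `1`
    (∃ C : ℝ, 0 < C ∧
      ∀ α : ℝ, 1 < α →
      ∀ g : ℝ × EuclideanSpace ℝ (Fin n) → ℂ, TentSpace.LocallySquareIntegrable g →
        TentSpace.tentNorm p α g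
          ≤ ENNReal.ofReal (C * α ^ TentSpace.expo n (min 2 p)) * TentSpace.tentNorm p 1 g ∧
        TentSpace.tentNorm p 1 g
          ≤ ENNReal.ofReal (C * α ^ (-TentSpace.expo n (max 2 p))) * TentSpace.tentNorm p α g) := by
  obtain ⟨C, hC, hle⟩ := TentSpace.exists_tentNorm_le n hp
  obtain ⟨c, c', hc, hc', hsharp⟩ := TentSpace.exists_tentNorm_comparable n hp
  refine ⟨⟨C⁻¹, C, by positivity, hC, fun α β hα hβ g _ => ⟨?_, hle α β hα hβ g⟩⟩,
    ⟨c, c', hc, hc', fun α β hα hβ => ⟨?_, ?_⟩⟩, ⟨C, hC, fun α hα g _ => ⟨?_, ?_⟩⟩⟩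
  · have hαβ : 0 < α / β := div_pos hα hβ
    have hL := TentSpace.hLower_pos n p hαβ
    -- The lower bound is the upper one from β to α, since the lower factor at ρ times the upper
    -- factor at 1/ρ is at most 1.
    calc ENNReal.ofReal (C⁻¹ * TentSpace.hLower n p (α / β)) * TentSpace.tentNorm p α g
        ≤ ENNReal.ofReal (C⁻¹ * TentSpace.hLower n p (α / β)) *
          (ENNReal.ofReal (C * TentSpace.hUpper n p (β / α)) * TentSpace.tentNorm p β g) := by
          gcongr
          exact hle β α hβ hα g
      _ = ENNReal.ofReal (TentSpace.hLower n p (α / β) * TentSpace.hUpper n p (α / β)⁻¹) *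
          TentSpace.tentNorm p β g := by
          rw [← mul_assoc, ← ENNReal.ofReal_mul (by positivity), inv_div]
          congr 2
          field_simp
      _ ≤ 1 * TentSpace.tentNorm p β g := by
          gcongr
          exact ENNReal.ofReal_le_one.2 (TentSpace.hLower_mul_hUpper_inv_le n p hαβ)
      _ = _ := one_mul _
  · obtain ⟨g, h1, h2, h3, h4, -⟩ :=
      hsharp α β hα hβ (TentSpace.hLower n p (α / β)) (min_choice _ _)
    exact ⟨g, h1, h2, h3, h4⟩
  · obtain ⟨g, h1, h2, h3, -, h4⟩ :=
      hsharp α β hα hβ (TentSpace.hUpper n p (α / β)) (max_choice _ _)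
    exact ⟨g, h1, h2, h3, h4⟩
  · have hα0 : 0 < α := one_pos.trans hα
    refine (hle 1 α one_pos hα0 g).trans ?_
    gcongr
    rw [one_div]
    exact TentSpace.hUpper_inv_le_rpow n hp hα.le
  · have hα0 : 0 < α := one_pos.trans hα
    refine (hle α 1 hα0 one_pos g).trans ?_
    gcongr
    rw [div_one]
    exact TentSpace.hUpper_le_rpow n hp hα.le
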